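/- Let $\Sigma$ be an alphabet (finite or infinite). **HDAs.** A *lo-set* is a finite set $U$ with a strict total order $\dashrightarrow$ and a labelling $\lambda:U\to\Sigma$; an *ilo-set* ${}_SU_T$ is a lo-set $U$ with subsets $S,T\subseteq U$ (source and target interface). Let $\mathrm{I}\square$ be the category whose objects are isomorphism classes of ilo-sets and whose morphisms $d_{A,B}:U\to V$ (coface maps) are triples $(\partial,A,B)$, where $\partial:U\to V$ preserves order and labels, $S_U=\partial^{-1}(S_V)$, $T_U=\partial^{-1}(T_V)$, $A,B$ are disjoint with $A\cup B=V\setminus\partial(U)$, $A\cap S_V=\emptyset$ and $B\cap T_V=\emptyset$; the composite is $(\partial',C,D)\circ(\partial,A,B)=(\partial'\partial,\partial'(A)\cup C,\partial'(B)\cup D)$. Let $\square$ be its full subcategory of objects with empty interfaces. A *higher-dimensional automaton* (HDA) is a presheaf $X$ on $\square$ with finitely many cells (elements of the sets $X[U]$), with sets $X_\bot$, $X^\top$ of start and accept cells. A *higher-dimensional automaton with interfaces* (iHDA) is a presheaf $X$ on $\mathrm{I}\square$ with finitely many cells and sets $X_\bot$, $X^\top$ of cells such that $S=U$ for every start cell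 in $X[{}_SU_T]$ and $T=U$ for every accept cell in $X[{}_SU_T]$. Write $\delta^0_A=X[d_{A,\emptyset}]$ and $\delta^1_B=X[d_{\emptyset,B}]$, and $\mathrm{ev}(x)=U$ for $x\in X[{}_SU_T]$. **Ipomsets.** A *labelled iposet* is a finite set $P$ with strict partial orders $<$ (precedence) and $\dashrightarrow$ (event order) such that any two distinct elements are comparable by $<$ or by $\dashrightarrow$, a labelling $\lambda:P\to\Sigma$, a set $S_P\subseteq P$ of $<$-minimal elements and a set $T_P\subseteq P$ of $<$-maximal elements. A *subsumption* $P\to Q$ is a label-preserving bijection $f$ with $f(S_P)=S_Q$, $f(T_P)=T_Q$, such that $f(x)<f(y)$ implies $x<y$, and such that $x\dashrightarrow y$ implies $f(x)\dashrightarrow f(y)$ whenever $x,y$ are $<$-incomparable. Write $P\sqsubseteq Q$ if there is one. An *isomorphism* is a subsumption that is also an isomorphism of the precedence orders; an *ipomset* is an isomorphism class of labelled iposets. An ipomset is an *interval* ipomset if there are $b,e:P\to\mathbb R$ with $b\le e$ and $x<y\iff e(x)<b(y)$. Ilo-sets are regarded as ipomsets with empty precedence; $\epsilon$ is the empty ipomset.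 The *parallel composition* $P\parallel Q$ has carrier $P\sqcup Q$, the unions of the interfaces and of the precedence orders, and $x\dashrightarrow y$ iff this holds in $P$ or in $Q$, or $x\in P$ and $y\in Q$. The *gluing composition* $P*Q$ is defined if the lo-sets $T_P$ and $S_Q$ are isomorphic; its carrier is $P\sqcup Q$ with $T_P$ and $S_Q$ identified along the unique isomorphism, $S_{P*Q}=S_P$, $T_{P*Q}=T_Q$, its event order is the transitive closure of the union of those of $P$ and $Q$, and $x<y$ iff $x<_Py$, or $x<_Qy$, or $x\in P\setminus T_P$ and $y\in Q\setminus S_Q$. **Regular languages.** A path in $X$ is a sequence of cells in which consecutive cells are joined by steps: up-steps $\delta^0_A(x)\to x$, with ipomset ${}_{U\setminus A}U_U$, and down-steps $x\to\delta^1_B(x)$, with ipomset ${}_UU_{U\setminus B}$, where $U=\mathrm{ev}(x)$. The ipomset $\mathrm{ev}(\alpha)$ of a path $\alpha$ is the gluing composition of the ipomsets of its steps, and ${}_UU_U$ with $U=\mathrm{ev}(x)$ if $\alpha$ consists of the single cell $x$. Let $L(X)$ be the set of the ipomsets $\mathrm{ev}(\alpha)$ of all paths $\alpha$ from a start cell to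 an accept cell. A set of ipomsets is *regular* if it is $L(X)$ for some HDA or iHDA $X$. **Rational languages.** For a set $A$ of ipomsets let $A{\downarrow}$ be the set of interval ipomsets $P$ with $P\sqsubseteq Q$ for some $Q\in A$. For sets $L,M$ of ipomsets put $L*M=\{P*Q\mid P\in L,\ Q\in M,\ T_P\simeq S_Q\}{\downarrow}$, $L\parallel M=\{P\parallel Q\mid P\in L,\ Q\in M\}{\downarrow}$ and $L^+=\bigcup_{n\ge1}L^n$ with $L^1=L$, $L^{n+1}=L*L^n$. The class of *rational* languages is the smallest class that contains $\emptyset$, $\{\epsilon\}$ and $\{p\}$ for every ipomset $p$ with exactly one event (with any label $a\in\Sigma$ and any of the four choices of interfaces), and that is closed under $\cup$, $*$, $\parallel$ and ${}^+$. **Proposition.** Every regular language is rational. -/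

import Mathlib

universe u w

namespace HigherDim

open CategoryTheory

/-! ## Lo-sets with interfaces and the labelled precube category with interfaces -/

/-- An isomorphism class of ilo-sets over the alphabet `Λ`: a word over
`{a, •a, a•, •a•}`, with the positions of the word as events. -/
structure ILoSet (Λ : Type u) where
  /-- number of events -/
  n : ℕ
  /-- labelling -/
  label : Fin n → Λ
  /-- source interface -/
  src : Set (Fin n)
  /-- target interface -/
  tgt : Set (Fin n)

/-- A coface map `d_{A,B} : U → V`: it inserts the events of `A` (unstarted in `U`) and of `B`
(terminated in `U`). -/
@[ext]
structure ILoSet.Hom {Λ : Type u} (U V : ILoSet Λ) where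
  toFun : Fin U.n → Fin V.n
  A : Set (Fin V.n)
  B : Set (Fin V.n)
  strictMono : StrictMono toFun
  label_eq : ∀ i, V.label (toFun i) = U.label i
  src_iff : ∀ i, toFun i ∈ V.src ↔ i ∈ U.src
  tgt_iff : ∀ i, toFun i ∈ V.tgt ↔ i ∈ U.tgt
  union_eq : A ∪ B = (Set.range toFun)ᶜ
  disj : Disjoint A B
  A_src : Disjoint A V.src
  B_tgt : Disjoint B V.tgt

/-- The identity coface map `d_{∅,∅}`. -/
def ILoSet.Hom.id {Λ : Type u} (U : ILoSet Λ) : U.Hom U where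
  toFun := fun i => i
  A := ∅
  B := ∅
  strictMono := strictMono_id
  label_eq := fun _ => rfl
  src_iff := fun _ => Iff.rfl
  tgt_iff := fun _ => Iff.rfl
  union_eq := by ext i; simp
  disj := by simp
  A_src := by simp
  B_tgt := by simp

/-- The composite `d_{C,D} ∘ d_{A,B} = d_{∂(A) ∪ C, ∂(B) ∪ D}`, where `∂` is the map underlying
`d_{C,D}`. -/
def ILoSet.Hom.comp {Λ : Type u} {U V W : ILoSet Λ} (f : U.Hom V) (g : V.Hom W) : U.Hom W where
  toFun := fun i => g.toFun (f.toFun i)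
  A := g.toFun '' f.A ∪ g.A
  B := g.toFun '' f.B ∪ g.B
  strictMono := g.strictMono.comp f.strictMono
  label_eq := fun i => by rw [g.label_eq, f.label_eq]
  src_iff := fun i => by rw [g.src_iff, f.src_iff]
  tgt_iff := fun i => by rw [g.tgt_iff, f.tgt_iff]
  union_eq := by
    have hg := g.strictMono.injective
    have h1 := fun x => Set.ext_iff.mp f.union_eq x
    have h2 := fun x => Set.ext_iff.mp g.union_eq x
    ext x
    simp only [Set.mem_union, Set.mem_image, Set.mem_compl_iff, Set.mem_range] at h1 h2 ⊢
    constructor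
    · rintro ((⟨y, hy, rfl⟩ | hx) | (⟨y, hy, rfl⟩ | hx)) ⟨i, hi⟩
      · exact (h1 y).1 (Or.inl hy) ⟨i, hg hi⟩
      · exact (h2 x).1 (Or.inl hx) ⟨_, hi⟩
      · exact (h1 y).1 (Or.inr hy) ⟨i, hg hi⟩
      · exact (h2 x).1 (Or.inr hx) ⟨_, hi⟩
    · intro hx
      by_cases hr : ∃ y, g.toFun y = x
      · obtain ⟨y, rfl⟩ := hr
        rcases (h1 y).2 (fun ⟨i, hi⟩ => hx ⟨i, by rw [hi]⟩) with h | h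
        · exact Or.inl (Or.inl ⟨y, h, rfl⟩)
        · exact Or.inr (Or.inl ⟨y, h, rfl⟩)
      · rcases (h2 x).2 hr with h | h
        · exact Or.inl (Or.inr h)
        · exact Or.inr (Or.inr h)
  disj := by
    have hg := g.strictMono.injective
    have h1 := Set.disjoint_left.mp f.disj
    have h2 := Set.disjoint_left.mp g.disj
    have h3 := fun x => Set.ext_iff.mp g.union_eq x
    simp only [Set.mem_union, Set.mem_compl_iff, Set.mem_range] at h3
    rw [Set.disjoint_left]
    rintro x (⟨y, hy, rfl⟩ | hx) (⟨z, hz, hzy⟩ | hx')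
    · exact h1 hy (hg hzy ▸ hz)
    · exact (h3 _).1 (Or.inr hx') ⟨y, rfl⟩
    · exact (h3 _).1 (Or.inl hx) ⟨z, hzy⟩
    · exact h2 hx hx'
  A_src := by
    rw [Set.disjoint_left]
    rintro x (⟨y, hy, rfl⟩ | hx) h
    · exact Set.disjoint_left.mp f.A_src hy ((g.src_iff y).1 h)
    · exact Set.disjoint_left.mp g.A_src hx h
  B_tgt := by
    rw [Set.disjoint_left]
    rintro x (⟨y, hy, rfl⟩ | hx) h
    · exact Set.disjoint_left.mp f.B_tgt hy ((g.tgt_iff y).1 h)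
    · exact Set.disjoint_left.mp g.B_tgt hx h

/-- The labelled precube category with interfaces (in its skeletal form). -/
instance ILoSet.category {Λ : Type u} : Category.{0} (ILoSet Λ) where
  Hom := ILoSet.Hom
  id := ILoSet.Hom.id
  comp := ILoSet.Hom.comp
  id_comp := fun f => by
    apply ILoSet.Hom.ext <;> simp [ILoSet.Hom.comp, ILoSet.Hom.id]
  comp_id := fun f => by
    apply ILoSet.Hom.ext <;> simp [ILoSet.Hom.comp, ILoSet.Hom.id]
  assoc := fun f g h => by
    apply ILoSet.Hom.ext <;>
      simp [ILoSet.Hom.comp, Set.image_union, Set.image_image, Set.union_assoc]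

/-! ## Precubical sets with interfaces, HDAs and iHDAs -/

/-- A precubical set with interfaces: a presheaf on the category of ilo-sets. -/
abbrev IpcSet (Λ : Type u) := (ILoSet Λ)ᵒᵖ ⥤ Type w

/-- The cells of a precubical set with interfaces. -/
abbrev IpcSet.Cell {Λ : Type u} (X : IpcSet.{u, w} Λ) := Σ U : ILoSet Λ, X.obj (Opposite.op U)

/-- A finite precubical set with interfaces, with sets of start and accept cells. -/
structure Automaton (Λ : Type u) where
  toIpc : IpcSet.{u, w} Λ
  finite : Finite toIpc.Cell
  start : Set toIpc.Cell
  accept : Set toIpc.Cell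

/-- `X` is an HDA: its underlying precubical set has no interfaces (precubical sets, that is,
presheaves on the category of lo-sets, are regarded as precubical sets with interfaces
that have cells over ilo-sets with empty interfaces only). -/
def Automaton.IsHDA {Λ : Type u} (X : Automaton.{u, w} Λ) : Prop :=
  ∀ x : X.toIpc.Cell, x.1.src = ∅ ∧ x.1.tgt = ∅

/-- `X` is an iHDA: all events of start cells are source events and all events of accept cells
are target events. -/
def Automaton.IsIHDA {Λ : Type u} (X : Automaton.{u, w} Λ) : Prop :=
  (∀ x ∈ X.start, x.1.src = Set.univ) ∧ (∀ x ∈ X.accept, x.1.tgt = Set.univ)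

/-! ## Ipomsets -/

/-- A labelled iposet: precedence order `lt`, event order `ev`, source and target
interfaces `S` and `T`. -/
structure Iposet (Λ : Type u) where
  carrier : Type
  finite : Finite carrier
  lt : carrier → carrier → Prop
  ev : carrier → carrier → Prop
  lt_irrefl : ∀ x, ¬ lt x x
  lt_trans : ∀ x y z, lt x y → lt y z → lt x z
  ev_irrefl : ∀ x, ¬ ev x x
  ev_trans : ∀ x y z, ev x y → ev y z → ev x z
  comparable : ∀ x y, x = y ∨ lt x y ∨ lt y x ∨ ev x y ∨ ev y x
  label : carrier → Λ
  S : Set carrier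
  T : Set carrier
  S_minimal : ∀ x ∈ S, ∀ y, ¬ lt y x
  T_maximal : ∀ x ∈ T, ∀ y, ¬ lt x y

/-- `f` is a subsumption: a bijection that respects labels and interfaces, reflects precedence
and preserves the event order of concurrent events. -/
structure Iposet.IsSubsumption {Λ : Type u} (P Q : Iposet Λ) (f : P.carrier ≃ Q.carrier) :
    Prop where
  label_eq : ∀ x, Q.label (f x) = P.label x
  S_iff : ∀ x, f x ∈ Q.S ↔ x ∈ P.S
  T_iff : ∀ x, f x ∈ Q.T ↔ x ∈ P.T
  reflects : ∀ x y, Q.lt (f x) (f y) → P.lt x y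
  preserves : ∀ x y, P.ev x y → ¬ P.lt x y → ¬ P.lt y x → Q.ev (f x) (f y)

/-- `P ⊑ Q` for labelled iposets. -/
def Iposet.Subsumed {Λ : Type u} (P Q : Iposet Λ) : Prop :=
  ∃ f : P.carrier ≃ Q.carrier, P.IsSubsumption Q f

/-- Isomorphism of labelled iposets: a subsumption that is an isomorphism of precedence orders
(its inverse is then a subsumption, too). -/
def Iposet.Isomorphic {Λ : Type u} (P Q : Iposet Λ) : Prop :=
  ∃ f : P.carrier ≃ Q.carrier, P.IsSubsumption Q f ∧ ∀ x y, P.lt x y ↔ Q.lt (f x) (f y)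

theorem Iposet.Subsumed.trans {Λ : Type u} {P Q R : Iposet Λ} (h : P.Subsumed Q)
    (k : Q.Subsumed R) : P.Subsumed R := by
  obtain ⟨f, hf⟩ := h
  obtain ⟨g, hg⟩ := k
  refine ⟨f.trans g, ⟨fun x => ?_, fun x => ?_, fun x => ?_, fun x y h => ?_,
    fun x y h h1 h2 => ?_⟩⟩
  · simp [hg.label_eq, hf.label_eq]
  · simp [hg.S_iff, hf.S_iff]
  · simp [hg.T_iff, hf.T_iff]
  · exact hf.reflects _ _ (hg.reflects _ _ h)
  · exact hg.preserves _ _ (hf.preserves _ _ h h1 h2) (fun h => h1 (hf.reflects _ _ h))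
      (fun h => h2 (hf.reflects _ _ h))

theorem Iposet.Isomorphic.subsumed {Λ : Type u} {P Q : Iposet Λ} (h : P.Isomorphic Q) :
    P.Subsumed Q := ⟨h.choose, h.choose_spec.1⟩

theorem Iposet.Isomorphic.refl {Λ : Type u} (P : Iposet Λ) : P.Isomorphic P :=
  ⟨Equiv.refl _, ⟨fun _ => rfl, fun _ => Iff.rfl, fun _ => Iff.rfl, fun _ _ h => h,
    fun _ _ h _ _ => h⟩, fun _ _ => Iff.rfl⟩

theorem Iposet.Isomorphic.symm {Λ : Type u} {P Q : Iposet Λ} (h : P.Isomorphic Q) :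
    Q.Isomorphic P := by
  obtain ⟨f, hf, hlt⟩ := h
  refine ⟨f.symm, ⟨fun x => ?_, fun x => ?_, fun x => ?_, fun x y h => ?_,
    fun x y h h1 h2 => ?_⟩, fun x y => ?_⟩
  · simpa using (hf.label_eq (f.symm x)).symm
  · simpa using (hf.S_iff (f.symm x)).symm
  · simpa using (hf.T_iff (f.symm x)).symm
  · simpa using (hlt _ _).1 h
  · have h1' : ¬ P.lt (f.symm x) (f.symm y) := fun h => h1 (by simpa using (hlt _ _).1 h)
    have h2' : ¬ P.lt (f.symm y) (f.symm x) := fun h => h2 (by simpa using (hlt _ _).1 h)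
    rcases P.comparable (f.symm x) (f.symm y) with e | e | e | e | e
    · rw [f.symm.injective e] at h
      exact absurd h (Q.ev_irrefl _)
    · exact absurd e h1'
    · exact absurd e h2'
    · exact e
    · have := hf.preserves _ _ e h2' h1'
      simp only [Equiv.apply_symm_apply] at this
      exact absurd (Q.ev_trans _ _ _ h this) (Q.ev_irrefl _)
  · simpa using (hlt (f.symm x) (f.symm y)).symm

theorem Iposet.Isomorphic.trans {Λ : Type u} {P Q R : Iposet Λ} (h : P.Isomorphic Q)
    (k : Q.Isomorphic R) : P.Isomorphic R := by
  obtain ⟨f, hf, hlt⟩ := h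
  obtain ⟨g, hg, klt⟩ := k
  refine ⟨f.trans g, ⟨fun x => ?_, fun x => ?_, fun x => ?_, fun x y h => ?_,
    fun x y h h1 h2 => ?_⟩, fun x y => ?_⟩
  · simp [hg.label_eq, hf.label_eq]
  · simp [hg.S_iff, hf.S_iff]
  · simp [hg.T_iff, hf.T_iff]
  · exact hf.reflects _ _ (hg.reflects _ _ h)
  · exact hg.preserves _ _ (hf.preserves _ _ h h1 h2) (fun h => h1 (hf.reflects _ _ h))
      (fun h => h2 (hf.reflects _ _ h))
  · exact (hlt x y).trans (klt _ _)

instance Iposet.setoid (Λ : Type u) : Setoid (Iposet Λ) where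
  r := Iposet.Isomorphic
  iseqv := ⟨Iposet.Isomorphic.refl, Iposet.Isomorphic.symm, Iposet.Isomorphic.trans⟩

/-- An ipomset is an isomorphism class of labelled iposets. -/
def Ipomset (Λ : Type u) := Quotient (Iposet.setoid Λ)

/-- The isomorphism class of a labelled iposet. -/
def Ipomset.mk {Λ : Type u} (P : Iposet Λ) : Ipomset Λ := Quotient.mk (Iposet.setoid Λ) P

/-- `P ⊑ Q` for ipomsets. -/
def Ipomset.Subsumed {Λ : Type u} (P Q : Ipomset Λ) : Prop :=
  Quotient.liftOn₂ P Q Iposet.Subsumed fun _ _ _ _ h k => propext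
    ⟨fun hs => (Iposet.Isomorphic.symm h).subsumed.trans
        (hs.trans (Iposet.Isomorphic.subsumed k)),
      fun hs => (Iposet.Isomorphic.subsumed h).trans
        (hs.trans (Iposet.Isomorphic.symm k).subsumed)⟩

/-- `P` admits an interval representation. -/
def Iposet.IsInterval {Λ : Type u} (P : Iposet Λ) : Prop :=
  ∃ b e : P.carrier → ℝ, (∀ x, b x ≤ e x) ∧ ∀ x y, P.lt x y ↔ e x < b y

theorem Iposet.IsInterval.of_iso {Λ : Type u} {P Q : Iposet Λ} (h : P.Isomorphic Q)
    (hQ : Q.IsInterval) : P.IsInterval := by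
  obtain ⟨f, -, hlt⟩ := h
  obtain ⟨b, e, hbe, hr⟩ := hQ
  exact ⟨fun x => b (f x), fun x => e (f x), fun x => hbe _,
    fun x y => (hlt x y).trans (hr _ _)⟩

/-- Interval ipomsets. -/
def Ipomset.IsInterval {Λ : Type u} (P : Ipomset Λ) : Prop :=
  Quotient.liftOn P Iposet.IsInterval fun _ _ h => propext
    ⟨Iposet.IsInterval.of_iso (Iposet.Isomorphic.symm h), Iposet.IsInterval.of_iso h⟩

/-- An ilo-set regarded as a discrete labelled iposet. -/
def ILoSet.toIposet {Λ : Type u} (U : ILoSet Λ) : Iposet Λ where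
  carrier := Fin U.n
  finite := inferInstance
  lt := fun _ _ => False
  ev := fun i j => i < j
  lt_irrefl := fun _ h => h
  lt_trans := fun _ _ _ h _ => h
  ev_irrefl := fun i => lt_irrefl i
  ev_trans := fun _ _ _ h k => h.trans k
  comparable := fun i j => by rcases lt_trichotomy i j with h | h | h <;> simp [h]
  label := U.label
  S := U.src
  T := U.tgt
  S_minimal := fun _ _ _ h => h
  T_maximal := fun _ _ _ h => h

/-- The empty ipomset. -/
def Ipomset.empty (Λ : Type u) : Ipomset Λ :=
  Ipomset.mk (ILoSet.toIposet ⟨0, fun i => i.elim0, ∅, ∅⟩)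

/-- The singleton ipomsets `a`, `•a`, `a•` and `•a•`; `s` and `t` tell whether the event belongs
to the source and to the target interface. -/
def Ipomset.single {Λ : Type u} (a : Λ) (s t : Bool) : Ipomset Λ :=
  Ipomset.mk (ILoSet.toIposet ⟨1, fun _ => a, {_i | s = true}, {_i | t = true}⟩)

/-- Parallel composition. -/
def Iposet.par {Λ : Type u} (P Q : Iposet Λ) : Iposet Λ where
  carrier := P.carrier ⊕ Q.carrier
  finite := by
    have := P.finite
    have := Q.finite
    infer_instance
  lt := Sum.LiftRel P.lt Q.lt
  ev := Sum.Lex P.ev Q.ev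
  lt_irrefl := by
    rintro (x | x) h <;> cases h
    · exact P.lt_irrefl _ ‹_›
    · exact Q.lt_irrefl _ ‹_›
  lt_trans := by
    rintro _ _ _ (h | h) (k | k)
    · exact Sum.LiftRel.inl (P.lt_trans _ _ _ h k)
    · exact Sum.LiftRel.inr (Q.lt_trans _ _ _ h k)
  ev_irrefl := by
    rintro (x | x) h <;> cases h
    · exact P.ev_irrefl _ ‹_›
    · exact Q.ev_irrefl _ ‹_›
  ev_trans := by
    rintro (x | x) (y | y) (z | z) h k <;> simp only [Sum.lex_inl_inl, Sum.lex_inr_inr,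
      Sum.lex_inr_inl, Sum.Lex.sep] at h k ⊢
    · exact P.ev_trans _ _ _ h k
    · exact Q.ev_trans _ _ _ h k
  comparable := by
    rintro (x | x) (y | y)
    · simpa using P.comparable x y
    · simp
    · simp
    · simpa using Q.comparable x y
  label := Sum.elim P.label Q.label
  S := Sum.inl '' P.S ∪ Sum.inr '' Q.S
  T := Sum.inl '' P.T ∪ Sum.inr '' Q.T
  S_minimal := by
    rintro _ (⟨x, hx, rfl⟩ | ⟨x, hx, rfl⟩) _ (h | h)
    · exact P.S_minimal _ hx _ h
    · exact Q.S_minimal _ hx _ h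
  T_maximal := by
    rintro _ (⟨x, hx, rfl⟩ | ⟨x, hx, rfl⟩) _ (h | h)
    · exact P.T_maximal _ hx _ h
    · exact Q.T_maximal _ hx _ h

/-- The isomorphisms between two labelled sets equipped with relations (lo-isomorphisms, if the
relations are strict total orders). -/
def LoIso {Λ : Type u} {α β : Type} (r : α → α → Prop) (l : α → Λ) (s : β → β → Prop)
    (m : β → Λ) : Type :=
  {f : r ≃r s // ∀ x, m (f x) = l x}

/-- Lo-isomorphisms `T_P ≃ S_Q`; there is at most one. -/
def Iposet.Matching {Λ : Type u} (P Q : Iposet Λ) : Type :=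
  LoIso (fun x y : P.T => P.ev x y) (fun x : P.T => P.label x)
    (fun x y : Q.S => Q.ev x y) (fun x : Q.S => Q.label x)

/-- The carrier of the gluing composition: the quotient of `P ⊔ Q` that identifies `T_P` with
`S_Q`, represented as the disjoint union of `P` and `Q \ S_Q`. -/
abbrev Iposet.GlueCarrier {Λ : Type u} (P Q : Iposet Λ) : Type :=
  P.carrier ⊕ {y : Q.carrier // y ∉ Q.S}

open Classical in
/-- The structural inclusion of `Q` into the gluing composition of `P` and `Q`. -/
noncomputable def Iposet.glueInr {Λ : Type u} (P Q : Iposet Λ) (f : P.Matching Q)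
    (y : Q.carrier) : P.GlueCarrier Q :=
  if h : y ∈ Q.S then Sum.inl (f.1.symm ⟨y, h⟩).1 else Sum.inr ⟨y, h⟩

/-- The precedence order of the gluing composition. -/
inductive Iposet.GlueLt {Λ : Type u} (P Q : Iposet Λ) (f : P.Matching Q) :
    P.GlueCarrier Q → P.GlueCarrier Q → Prop
  | left (x y : P.carrier) : P.lt x y → GlueLt P Q f (Sum.inl x) (Sum.inl y)
  | right (x y : Q.carrier) : Q.lt x y → GlueLt P Q f (P.glueInr Q f x) (P.glueInr Q f y)
  | cross (x : P.carrier) (y : Q.carrier) : x ∉ P.T → y ∉ Q.S →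
      GlueLt P Q f (Sum.inl x) (P.glueInr Q f y)

/-- The union of the event orders of `P` and `Q` in the gluing composition. -/
inductive Iposet.GlueEvBase {Λ : Type u} (P Q : Iposet Λ) (f : P.Matching Q) :
    P.GlueCarrier Q → P.GlueCarrier Q → Prop
  | left (x y : P.carrier) : P.ev x y → GlueEvBase P Q f (Sum.inl x) (Sum.inl y)
  | right (x y : Q.carrier) : Q.ev x y →
      GlueEvBase P Q f (P.glueInr Q f x) (P.glueInr Q f y)

theorem Iposet.glueInr_mem {Λ : Type u} (P Q : Iposet Λ) (f : P.Matching Q) (t : P.T) :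
    P.glueInr Q f (f.1 t) = Sum.inl t.1 := by
  simp [Iposet.glueInr]

theorem Iposet.glueInr_notMem {Λ : Type u} (P Q : Iposet Λ) (f : P.Matching Q) (y : Q.carrier)
    (h : y ∉ Q.S) : P.glueInr Q f y = Sum.inr ⟨y, h⟩ := by
  simp [Iposet.glueInr, h]

theorem Iposet.glueInr_cases {Λ : Type u} (P Q : Iposet Λ) (f : P.Matching Q) (y : Q.carrier) :
    (∃ t : P.T, y = f.1 t ∧ P.glueInr Q f y = Sum.inl t.1) ∨
      ∃ h : y ∉ Q.S, P.glueInr Q f y = Sum.inr ⟨y, h⟩ := by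
  by_cases h : y ∈ Q.S
  · exact Or.inl ⟨f.1.symm ⟨y, h⟩, by simp, by simp [Iposet.glueInr, h]⟩
  · exact Or.inr ⟨h, P.glueInr_notMem Q f y h⟩

/-- Explicit form of the precedence order of the gluing composition. -/
def Iposet.GlueLtCases {Λ : Type u} (P Q : Iposet Λ) (f : P.Matching Q) :
    P.GlueCarrier Q → P.GlueCarrier Q → Prop
  | Sum.inl x, Sum.inl y => P.lt x y
  | Sum.inl x, Sum.inr y => x ∉ P.T ∨ ∃ t : P.T, x = t.1 ∧ Q.lt (f.1 t) y
  | Sum.inr _, Sum.inl _ => False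
  | Sum.inr x, Sum.inr y => Q.lt x y

theorem Iposet.glueLt_iff {Λ : Type u} (P Q : Iposet Λ) (f : P.Matching Q)
    (a b : P.GlueCarrier Q) : P.GlueLt Q f a b ↔ P.GlueLtCases Q f a b := by
  constructor
  · rintro (⟨x, y, h⟩ | ⟨x, y, h⟩ | ⟨x, y, hx, hy⟩)
    · exact h
    · rcases P.glueInr_cases Q f y with ⟨t, rfl, -⟩ | ⟨hy, ey⟩
      · exact absurd h (Q.S_minimal _ (f.1 t).2 _)
      · rw [ey]
        rcases P.glueInr_cases Q f x with ⟨t, rfl, ex⟩ | ⟨hx, ex⟩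
        · rw [ex]; exact Or.inr ⟨t, rfl, h⟩
        · rw [ex]; exact h
    · rw [P.glueInr_notMem Q f y hy]
      exact Or.inl hx
  · intro h
    rcases a with x | x <;> rcases b with y | y
    · exact GlueLt.left x y h
    · rw [show (Sum.inr y : P.GlueCarrier Q) = P.glueInr Q f y.1 from
        (P.glueInr_notMem Q f y.1 y.2).symm]
      rcases h with h | ⟨t, rfl, h⟩
      · exact GlueLt.cross x y.1 h y.2
      · rw [← P.glueInr_mem Q f t]
        exact GlueLt.right _ _ h
    · exact h.elim
    · rw [show (Sum.inr y : P.GlueCarrier Q) = P.glueInr Q f y.1 from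
        (P.glueInr_notMem Q f y.1 y.2).symm,
        show (Sum.inr x : P.GlueCarrier Q) = P.glueInr Q f x.1 from
        (P.glueInr_notMem Q f x.1 x.2).symm]
      exact GlueLt.right _ _ h

/-- Explicit form of the event order of the gluing composition. -/
def Iposet.GlueEvCases {Λ : Type u} (P Q : Iposet Λ) (f : P.Matching Q) :
    P.GlueCarrier Q → P.GlueCarrier Q → Prop
  | Sum.inl x, Sum.inl y => P.ev x y
  | Sum.inl x, Sum.inr y => ∃ t : P.T, (x = t.1 ∨ P.ev x t.1) ∧ Q.ev (f.1 t) y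
  | Sum.inr x, Sum.inl y => ∃ t : P.T, Q.ev x (f.1 t) ∧ (t.1 = y ∨ P.ev t.1 y)
  | Sum.inr x, Sum.inr y => Q.ev x y

theorem Iposet.Matching.ev_iff {Λ : Type u} {P Q : Iposet Λ} (f : P.Matching Q) (s t : P.T) :
    Q.ev (f.1 s) (f.1 t) ↔ P.ev s t := f.1.map_rel_iff (a := s) (b := t)

theorem Iposet.glueEvCases_trans {Λ : Type u} (P Q : Iposet Λ) (f : P.Matching Q)
    (a b c : P.GlueCarrier Q) (h : P.GlueEvCases Q f a b) (k : P.GlueEvCases Q f b c) :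
    P.GlueEvCases Q f a c := by
  have hP := P.ev_trans
  have hQ := Q.ev_trans
  have hf := f.ev_iff
  rcases a with x | x <;> rcases b with y | y <;> rcases c with z | z <;>
    simp only [Iposet.GlueEvCases] at h k ⊢
  · exact hP _ _ _ h k
  · obtain ⟨t, ht, k⟩ := k
    exact ⟨t, Or.inr (by rcases ht with rfl | ht; exacts [h, hP _ _ _ h ht]), k⟩
  · obtain ⟨t, ht, h⟩ := h
    obtain ⟨s, k, hs⟩ := k
    have hts := (hf t s).1 (hQ _ _ _ h k)
    have h1 : P.ev x s := by rcases ht with rfl | ht; exacts [hts, hP _ _ _ ht hts]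
    rcases hs with rfl | hs
    exacts [h1, hP _ _ _ h1 hs]
  · obtain ⟨t, ht, h⟩ := h
    exact ⟨t, ht, hQ _ _ _ h k⟩
  · obtain ⟨t, h, ht⟩ := h
    exact ⟨t, h, Or.inr (by rcases ht with rfl | ht; exacts [k, hP _ _ _ ht k])⟩
  · obtain ⟨t, h, ht⟩ := h
    obtain ⟨s, hs, k⟩ := k
    have hts : t = s ∨ P.ev t s := by
      rcases ht with rfl | ht <;> rcases hs with e | hs
      · exact Or.inl (Subtype.ext e)
      · exact Or.inr hs
      · exact Or.inr (e ▸ ht)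
      · exact Or.inr (hP _ _ _ ht hs)
    rcases hts with rfl | hts
    · exact hQ _ _ _ h k
    · exact hQ _ _ _ h (hQ _ _ _ ((hf t s).2 hts) k)
  · obtain ⟨t, k, ht⟩ := k
    exact ⟨t, hQ _ _ _ h k, ht⟩
  · exact hQ _ _ _ h k

theorem Iposet.glueEv_cases {Λ : Type u} (P Q : Iposet Λ) (f : P.Matching Q)
    (a b : P.GlueCarrier Q) (h : Relation.TransGen (P.GlueEvBase Q f) a b) :
    P.GlueEvCases Q f a b := by
  have base : ∀ a b, P.GlueEvBase Q f a b → P.GlueEvCases Q f a b := by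
    rintro _ _ (⟨x, y, h⟩ | ⟨x, y, h⟩)
    · exact h
    · rcases P.glueInr_cases Q f x with ⟨t, rfl, ex⟩ | ⟨hx, ex⟩ <;>
        rcases P.glueInr_cases Q f y with ⟨s, rfl, ey⟩ | ⟨hy, ey⟩ <;> rw [ex, ey]
      · exact (f.ev_iff t s).1 h
      · exact ⟨t, Or.inl rfl, h⟩
      · exact ⟨s, h, Or.inl rfl⟩
      · exact h
  induction h with
  | single h => exact base _ _ h
  | tail _ h ih => exact P.glueEvCases_trans Q f _ _ _ ih (base _ _ h)

/-- The gluing composition `P * Q` along the isomorphism `f : T_P ≃ S_Q`. -/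
noncomputable def Iposet.glue {Λ : Type u} (P Q : Iposet Λ) (f : P.Matching Q) : Iposet Λ where
  carrier := P.GlueCarrier Q
  finite := by
    have := P.finite
    have := Q.finite
    infer_instance
  lt := P.GlueLt Q f
  ev := Relation.TransGen (P.GlueEvBase Q f)
  lt_irrefl := fun x h => by
    rw [P.glueLt_iff] at h
    rcases x with x | x
    · exact P.lt_irrefl _ h
    · exact Q.lt_irrefl _ h
  lt_trans := fun x y z h k => by
    rw [P.glueLt_iff] at h k ⊢
    rcases x with x | x <;> rcases y with y | y <;> rcases z with z | z <;>
      simp only [Iposet.GlueLtCases] at h k ⊢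
    · exact P.lt_trans _ _ _ h k
    · exact Or.inl fun hx => P.T_maximal _ hx _ h
    · rcases h with h | ⟨t, rfl, h⟩
      · exact Or.inl h
      · exact Or.inr ⟨t, rfl, Q.lt_trans _ _ _ h k⟩
    · exact Q.lt_trans _ _ _ h k
  ev_irrefl := fun x h => by
    have h := P.glueEv_cases Q f _ _ h
    rcases x with x | x
    · exact P.ev_irrefl _ h
    · exact Q.ev_irrefl _ h
  ev_trans := fun _ _ _ h k => h.trans k
  comparable := fun a b => by
    have key : ∀ (x : P.carrier) (y : {y : Q.carrier // y ∉ Q.S}),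
        P.GlueLt Q f (Sum.inl x) (Sum.inr y) ∨
        Relation.TransGen (P.GlueEvBase Q f) (Sum.inl x) (Sum.inr y) ∨
        Relation.TransGen (P.GlueEvBase Q f) (Sum.inr y) (Sum.inl x) := by
      intro x y
      have ey := P.glueInr_notMem Q f y.1 y.2
      by_cases hx : x ∈ P.T
      · have ex := P.glueInr_mem Q f ⟨x, hx⟩
        rcases Q.comparable (f.1 ⟨x, hx⟩) y.1 with e | e | e | e | e
        · exact absurd (e ▸ (f.1 ⟨x, hx⟩).2) y.2
        · exact Or.inl ((P.glueLt_iff Q f _ _).2 (Or.inr ⟨⟨x, hx⟩, rfl, e⟩))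
        · exact absurd e (Q.S_minimal _ (f.1 ⟨x, hx⟩).2 _)
        · have := GlueEvBase.right (P := P) (f := f) _ _ e
          rw [ex, ey] at this
          exact Or.inr (Or.inl (Relation.TransGen.single this))
        · have := GlueEvBase.right (P := P) (f := f) _ _ e
          rw [ex, ey] at this
          exact Or.inr (Or.inr (Relation.TransGen.single this))
      · exact Or.inl ((P.glueLt_iff Q f _ _).2 (Or.inl hx))
    rcases a with x | x <;> rcases b with y | y
    · rcases P.comparable x y with rfl | e | e | e | e
      · exact Or.inl rfl
      · exact Or.inr (Or.inl (GlueLt.left _ _ e))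
      · exact Or.inr (Or.inr (Or.inl (GlueLt.left _ _ e)))
      · exact Or.inr (Or.inr (Or.inr (Or.inl (Relation.TransGen.single
          (GlueEvBase.left _ _ e)))))
      · exact Or.inr (Or.inr (Or.inr (Or.inr (Relation.TransGen.single
          (GlueEvBase.left _ _ e)))))
    · rcases key x y with e | e | e <;> simp [e]
    · rcases key y x with e | e | e <;> simp [e]
    · have ex := P.glueInr_notMem Q f x.1 x.2
      have ey := P.glueInr_notMem Q f y.1 y.2
      rcases Q.comparable x.1 y.1 with e | e | e | e | e
      · exact Or.inl (by rw [Subtype.ext e])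
      · exact Or.inr (Or.inl ((P.glueLt_iff Q f _ _).2 e))
      · exact Or.inr (Or.inr (Or.inl ((P.glueLt_iff Q f _ _).2 e)))
      · have := GlueEvBase.right (P := P) (f := f) _ _ e
        rw [ex, ey] at this
        exact Or.inr (Or.inr (Or.inr (Or.inl (Relation.TransGen.single this))))
      · have := GlueEvBase.right (P := P) (f := f) _ _ e
        rw [ex, ey] at this
        exact Or.inr (Or.inr (Or.inr (Or.inr (Relation.TransGen.single this))))
  label := Sum.elim P.label fun y => Q.label y.1
  S := Sum.inl '' P.S
  T := P.glueInr Q f '' Q.T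
  S_minimal := by
    rintro _ ⟨x, hx, rfl⟩ y h
    rw [P.glueLt_iff] at h
    rcases y with y | y
    · exact P.S_minimal _ hx _ h
    · exact h
  T_maximal := by
    rintro _ ⟨x, hx, rfl⟩ y h
    rw [P.glueLt_iff] at h
    rcases P.glueInr_cases Q f x with ⟨t, rfl, ex⟩ | ⟨hx', ex⟩ <;> rw [ex] at h <;>
      rcases y with y | y
    · exact P.T_maximal _ t.2 _ h
    · rcases h with h | ⟨s, hs, h⟩
      · exact h t.2
      · rw [← Subtype.ext hs] at h
        exact Q.T_maximal _ hx _ h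
    · exact h
    · exact Q.T_maximal _ hx _ h

/-! ## Rational languages -/

/-- The down-closure of a set of ipomsets, within interval ipomsets. -/
def down {Λ : Type u} (A : Set (Ipomset Λ)) : Set (Ipomset Λ) :=
  {P | P.IsInterval ∧ ∃ Q ∈ A, P.Subsumed Q}

/-- The gluing composition of languages. -/
def langGlue {Λ : Type u} (L M : Set (Ipomset Λ)) : Set (Ipomset Λ) :=
  down {R | ∃ (P Q : Iposet Λ) (f : P.Matching Q),
    Ipomset.mk P ∈ L ∧ Ipomset.mk Q ∈ M ∧ R = Ipomset.mk (P.glue Q f)}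

/-- The parallel composition of languages. -/
def langPar {Λ : Type u} (L M : Set (Ipomset Λ)) : Set (Ipomset Λ) :=
  down {R | ∃ P Q : Iposet Λ,
    Ipomset.mk P ∈ L ∧ Ipomset.mk Q ∈ M ∧ R = Ipomset.mk (P.par Q)}

/-- `langPow L n` is the power of `L` with exponent `n + 1`. -/
def langPow {Λ : Type u} (L : Set (Ipomset Λ)) : ℕ → Set (Ipomset Λ)
  | 0 => L
  | n + 1 => langGlue L (langPow L n)

/-- Kleene plus. -/
def langPlus {Λ : Type u} (L : Set (Ipomset Λ)) : Set (Ipomset Λ) := ⋃ n, langPow L n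

/-- The smallest class that contains the empty language, the language of the empty ipomset and
the languages of the singleton ipomsets, and that is closed under union, gluing composition,
parallel composition and Kleene plus. -/
inductive IsRational {Λ : Type u} : Set (Ipomset Λ) → Prop
  | empty : IsRational ∅
  | epsilon : IsRational {Ipomset.empty Λ}
  | single (a : Λ) (s t : Bool) : IsRational {Ipomset.single a s t}
  | union (L M : Set (Ipomset Λ)) : IsRational L → IsRational M → IsRational (L ∪ M)
  | glue (L M : Set (Ipomset Λ)) : IsRational L → IsRational M → IsRational (langGlue L M)
  | par (L M : Set (Ipomset Λ)) : IsRational L → IsRational M → IsRational (langPar L M)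
  | plus (L : Set (Ipomset Λ)) : IsRational L → IsRational (langPlus L)

/-! ## Paths and regular languages -/

/-- Up-steps and down-steps between cells. -/
inductive Step {Λ : Type u} (X : IpcSet.{u, w} Λ) : X.Cell → X.Cell → Type (max u w)
  | up {x y : X.Cell} (φ : x.1 ⟶ y.1) (hB : φ.B = ∅) (h : X.map φ.op y.2 = x.2) : Step X x y
  | down {x y : X.Cell} (φ : y.1 ⟶ x.1) (hA : φ.A = ∅) (h : X.map φ.op x.2 = y.2) : Step X x y

/-- Paths, as sequences of steps. -/
inductive Path {Λ : Type u} (X : IpcSet.{u, w} Λ) : X.Cell → X.Cell → Type (max u w)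
  | nil (x : X.Cell) : Path X x x
  | cons {x y z : X.Cell} (s : Step X x y) (p : Path X y z) : Path X x z

/-- The ilo-set with the underlying lo-set of `U` and the interfaces `S` and `T`. -/
def ILoSet.withInterfaces {Λ : Type u} (U : ILoSet Λ) (S T : Set (Fin U.n)) : ILoSet Λ :=
  ⟨U.n, U.label, S, T⟩

/-- The labelled iposet of a step: source `U \ A` and target `U` for an up-step that starts `A`,
source `U` and target `U \ B` for a down-step that terminates `B`. -/
def Step.ev {Λ : Type u} {X : IpcSet.{u, w} Λ} {x y : X.Cell} : Step X x y → Iposet Λ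
  | .up φ _ _ => (y.1.withInterfaces φ.Aᶜ Set.univ).toIposet
  | .down φ _ _ => (x.1.withInterfaces Set.univ φ.Bᶜ).toIposet

/-- Lo-isomorphisms from the lo-set underlying `U` to the source interface of `P`. -/
def ILoSet.SrcIso {Λ : Type u} (U : ILoSet Λ) (P : Iposet Λ) : Type :=
  LoIso (fun i j : Fin U.n => i < j) U.label (fun x y : P.S => P.ev x y)
    (fun x : P.S => P.label x)

/-- Lo-isomorphisms from the target interface of `P` to the lo-set underlying `U`. -/
def ILoSet.TgtIso {Λ : Type u} (U : ILoSet Λ) (P : Iposet Λ) : Type :=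
  LoIso (fun x y : P.T => P.ev x y) (fun x : P.T => P.label x)
    (fun i j : Fin U.n => i < j) U.label

/-- Composition of lo-isomorphisms. -/
def LoIso.trans {Λ : Type u} {α β γ : Type} {r : α → α → Prop} {l : α → Λ}
    {s : β → β → Prop} {m : β → Λ} {t : γ → γ → Prop} {k : γ → Λ}
    (f : LoIso r l s m) (g : LoIso s m t k) : LoIso r l t k :=
  ⟨f.1.trans g.1, fun x => (g.2 _).trans (f.2 x)⟩

/-- Inverse of a lo-isomorphism. -/
def LoIso.symm {Λ : Type u} {α β : Type} {r : α → α → Prop} {l : α → Λ}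
    {s : β → β → Prop} {m : β → Λ} (f : LoIso r l s m) : LoIso s m r l :=
  ⟨f.1.symm, fun x => by simpa using (f.2 (f.1.symm x)).symm⟩

/-- The whole lo-set as a subset of itself. -/
def ILoSet.univIso {Λ : Type u} (U : ILoSet Λ) :
    LoIso (fun i j : Fin U.n => i < j) U.label
      (fun x y : (Set.univ : Set (Fin U.n)) => x.1 < y.1) (fun x => U.label x.1) :=
  ⟨⟨(Equiv.Set.univ (Fin U.n)).symm, Iff.rfl⟩, fun _ => rfl⟩

/-- A coface map identifies its domain with a subset of its codomain. -/
noncomputable def ILoSet.Hom.rangeIso {Λ : Type u} {U V : ILoSet Λ} (φ : U.Hom V)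
    (C : Set (Fin V.n)) (hC : Set.range φ.toFun = C) :
    LoIso (fun i j : Fin U.n => i < j) U.label
      (fun x y : C => x.1 < y.1) (fun x => V.label x.1) :=
  ⟨⟨(Equiv.ofInjective φ.toFun φ.strictMono.injective).trans (Equiv.setCongr hC),
    fun {_ _} => φ.strictMono.lt_iff_lt⟩, fun i => φ.label_eq i⟩

theorem ILoSet.Hom.range_of_B {Λ : Type u} {U V : ILoSet Λ} (φ : U.Hom V) (h : φ.B = ∅) :
    Set.range φ.toFun = φ.Aᶜ := by
  have := φ.union_eq
  rw [h, Set.union_empty] at this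
  rw [this, compl_compl]

theorem ILoSet.Hom.range_of_A {Λ : Type u} {U V : ILoSet Λ} (φ : U.Hom V) (h : φ.A = ∅) :
    Set.range φ.toFun = φ.Bᶜ := by
  have := φ.union_eq
  rw [h, Set.empty_union] at this
  rw [this, compl_compl]

/-- The source interface of a step is the lo-set of its source cell. -/
noncomputable def Step.srcIso {Λ : Type u} {X : IpcSet.{u, w} Λ} {x y : X.Cell} :
    (s : Step X x y) → x.1.SrcIso s.ev
  | .up φ hB _ => ILoSet.Hom.rangeIso φ _ (ILoSet.Hom.range_of_B φ hB)
  | .down _ _ _ => x.1.univIso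

/-- The target interface of a step is the lo-set of its target cell. -/
noncomputable def Step.tgtIso {Λ : Type u} {X : IpcSet.{u, w} Λ} {x y : X.Cell} :
    (s : Step X x y) → y.1.TgtIso s.ev
  | .up _ _ _ => y.1.univIso.symm
  | .down φ hA _ => (ILoSet.Hom.rangeIso φ _ (ILoSet.Hom.range_of_A φ hA)).symm

/-- The source interface of a gluing composition. -/
noncomputable def Iposet.glueSrcIso {Λ : Type u} (P Q : Iposet Λ) (f : P.Matching Q) :
    LoIso (fun x y : P.S => P.ev x y) (fun x : P.S => P.label x)
      (fun x y : (P.glue Q f).S => (P.glue Q f).ev x y)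
      (fun x : (P.glue Q f).S => (P.glue Q f).label x) :=
  ⟨⟨Equiv.Set.image Sum.inl P.S Sum.inl_injective, fun {x y} =>
    ⟨fun h => P.glueEv_cases Q f (Sum.inl x.1) (Sum.inl y.1) h,
      fun h => Relation.TransGen.single (GlueEvBase.left x.1 y.1 h)⟩⟩, fun _ => rfl⟩

/-- The labelled iposet of a path, with the identification of its source interface and the
lo-set of the first cell: the identity iposet of the cell for a path without steps, and the
gluing composition of the iposets of the steps in general. -/
noncomputable def Path.evAux {Λ : Type u} {X : IpcSet.{u, w} Λ} {x y : X.Cell} :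
    Path X x y → (P : Iposet Λ) × x.1.SrcIso P
  | .nil x => ⟨(x.1.withInterfaces Set.univ Set.univ).toIposet, x.1.univIso⟩
  | .cons s p =>
    ⟨s.ev.glue p.evAux.1 (s.tgtIso.trans p.evAux.2),
      s.srcIso.trans (s.ev.glueSrcIso p.evAux.1 (s.tgtIso.trans p.evAux.2))⟩

/-- The ipomset of a path. -/
noncomputable def Path.ev {Λ : Type u} {X : IpcSet.{u, w} Λ} {x y : X.Cell} (p : Path X x y) :
    Ipomset Λ :=
  Ipomset.mk p.evAux.1

/-- The set of ipomsets of the accepting paths. -/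
def Automaton.Lang {Λ : Type u} (X : Automaton.{u, w} Λ) : Set (Ipomset Λ) :=
  {P | ∃ x ∈ X.start, ∃ y ∈ X.accept, ∃ p : Path X.toIpc x y, P = p.ev}

/-- Regular languages: those recognised by an HDA or by an iHDA. -/
def IsRegular {Λ : Type u} (L : Set (Ipomset Λ)) : Prop :=
  ∃ X : Automaton.{u, w} Λ, (X.IsHDA ∨ X.IsIHDA) ∧ X.Lang = L

end HigherDim

/-
Kleene's construction applies once the language of the paths between two cells is known to be closed
under the subsumption closure that is part of `langGlue`, and this is the main point. The cells met
when the events of an ipomset `P` are executed along a path extend to a compatible family of cells,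
one for each consistent state of the events of `P`, where an event is unstarted, active or
terminated. Such a realization of `P` in `X` is a map to `X` from the cube complex of `P`. If `P` is
subsumed by `Q` then every consistent state of `P` is one of `Q`, so realizations are inherited by
subsumption. They compose along gluing compositions. If `P` is an interval ipomset, then a
realization can be read off as a path: if some minimal event is not in the source interface then it
is started, and otherwise the event whose interval ends first is terminated, which is possible since
it precedes all unstarted events.
-/

namespace HigherDim

open CategoryTheory

/-! ## Cells with named events -/

section

/-- The status of an event during an execution. -/
inductive Status
  | unstarted
  | active
  | terminated

/-- A cell of `X` whose events carry names in `V`. -/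
abbrev Marked {Λ : Type u} (X : IpcSet.{u, w} Λ) (V : Type) := Σ x : X.Cell, (Fin x.1.n → V)

/-- `c` is obtained from `c'` by unstarting or terminating some of the active events. On consistent
states of an iposet, this is the face relation of its cube complex. -/
def IsSubstate {V : Type} (c c' : V → Status) : Prop := ∀ p, c' p ≠ .active → c p = c' p

variable {Λ : Type u}

section Coface

variable {U U' V : ILoSet Λ}

theorem ILoSet.Hom.mem_range_iff (φ : U.Hom V) (i : Fin V.n) :
    i ∈ Set.range φ.toFun ↔ i ∉ φ.A ∧ i ∉ φ.B := by
  have := Set.ext_iff.mp φ.union_eq i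
  simp only [Set.mem_union, Set.mem_compl_iff] at this
  tauto

theorem ILoSet.Hom.dom_unique (φ : U.Hom V) (ψ : U'.Hom V) (hA : φ.A = ψ.A) (hB : φ.B = ψ.B) :
    ∃ h : U = U', h ▸ φ = ψ := by
  have range_eq : Set.range φ.toFun = Set.range ψ.toFun := by
    ext i
    rw [φ.mem_range_iff, ψ.mem_range_iff, hA, hB]
  obtain ⟨n, l, s, t⟩ := U
  obtain ⟨n', l', s', t'⟩ := U'
  obtain rfl : n = n' := by
    have hn := Set.ncard_range_of_injective φ.strictMono.injective
    rw [range_eq, Set.ncard_range_of_injective ψ.strictMono.injective] at hn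
    simpa using hn.symm
  have toFun_eq : φ.toFun = ψ.toFun := (StrictMono.range_inj φ.strictMono ψ.strictMono).1 range_eq
  obtain rfl : l = l' := funext fun i => (φ.label_eq i).symm.trans (toFun_eq ▸ ψ.label_eq i)
  obtain rfl : s = s' := Set.ext fun i => (φ.src_iff i).symm.trans (toFun_eq ▸ ψ.src_iff i)
  obtain rfl : t = t' := Set.ext fun i => (φ.tgt_iff i).symm.trans (toFun_eq ▸ ψ.tgt_iff i)
  exact ⟨rfl, ILoSet.Hom.ext toFun_eq hA hB⟩

theorem ILoSet.exists_hom (V : ILoSet Λ) {A B : Set (Fin V.n)} (disj : Disjoint A B)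
    (hA : Disjoint A V.src) (hB : Disjoint B V.tgt) :
    ∃ (U : ILoSet Λ) (φ : U.Hom V), φ.A = A ∧ φ.B = B := by
  classical
  let s : Finset (Fin V.n) := Finset.univ.filter fun i => i ∉ A ∪ B
  let e := s.orderEmbOfFin rfl
  have range_e : Set.range e = (A ∪ B)ᶜ := by
    simp only [e, Finset.range_orderEmbOfFin, s, Finset.coe_filter_univ]
    rfl
  exact ⟨⟨s.card, fun i => V.label (e i), e ⁻¹' V.src, e ⁻¹' V.tgt⟩,
    { toFun := e
      A := A
      B := B
      strictMono := e.strictMono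
      label_eq := fun _ => rfl
      src_iff := fun _ => Iff.rfl
      tgt_iff := fun _ => Iff.rfl
      union_eq := by rw [range_e, compl_compl]
      disj := disj
      A_src := hA
      B_tgt := hB }, rfl, rfl⟩

end Coface

section

variable {α : Type*} [LinearOrder α] {P : Iposet Λ} {i : α → P.carrier}
  (mono : ∀ a b, a < b → P.ev (i a) (i b))

include mono

theorem Iposet.injective_of_ev : Function.Injective i := by
  intro a b e
  rcases lt_trichotomy a b with lt | eq | lt
  · exact absurd (e ▸ mono a b lt) (P.ev_irrefl _)
  · exact eq
  · exact absurd (e ▸ mono b a lt) (P.ev_irrefl _)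

theorem Iposet.ev_iff_lt_of_ev {a b : α} : P.ev (i a) (i b) ↔ a < b := by
  refine ⟨fun h => ?_, mono a b⟩
  rcases lt_trichotomy a b with lt | rfl | lt
  · exact lt
  · exact absurd h (P.ev_irrefl _)
  · exact absurd (P.ev_trans _ _ _ h (mono _ _ lt)) (P.ev_irrefl _)

end

variable {X : IpcSet.{u, w} Λ}

namespace Marked

section Face

variable {V W : Type} {c c' : V → Status} {m m' m'' : Marked X V}

/-- Renaming of events. -/
def map (f : V → W) (m : Marked X V) : Marked X W := ⟨m.1, f ∘ m.2⟩

/-- `m` is the face of `m'` obtained by unstarting the events of `m'` that are unstarted in `c` and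
terminating those that are terminated in `c`. -/
def IsFace (c : V → Status) (m m' : Marked X V) : Prop :=
  ∃ φ : m.1.1 ⟶ m'.1.1, (∀ i, m'.2 (φ.toFun i) = m.2 i) ∧
    φ.A = {i | c (m'.2 i) = .unstarted} ∧ φ.B = {i | c (m'.2 i) = .terminated} ∧
    X.map φ.op m'.1.2 = m.1.2

theorem IsFace.unique {m₁ m₂ : Marked X V} (h₁ : IsFace c m₁ m) (h₂ : IsFace c m₂ m) :
    m₁ = m₂ := by
  obtain ⟨φ, hφ, hA, hB, hX⟩ := h₁
  obtain ⟨ψ, hψ, kA, kB, kX⟩ := h₂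
  obtain ⟨hU, hφψ⟩ := ILoSet.Hom.dom_unique φ ψ (hA.trans kA.symm) (hB.trans kB.symm)
  obtain ⟨⟨U, x⟩, g⟩ := m₁
  obtain ⟨⟨U', x'⟩, g'⟩ := m₂
  dsimp only at hU φ ψ
  subst hU
  dsimp only at hφψ
  subst hφψ
  obtain rfl : x = x' := hX.symm.trans kX
  obtain rfl : g = g' := funext fun i => (hφ i).symm.trans (hψ i)
  rfl

theorem IsFace.map (f : V → W) {c : W → Status} (h : IsFace (c ∘ f) m m') :
    IsFace c (m.map f) (m'.map f) := by
  obtain ⟨φ, hφ, hA, hB, hX⟩ := h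
  exact ⟨φ, fun i => congrArg f (hφ i), hA, hB, hX⟩

theorem isFace_self (hc : ∀ v, c v = .active) : IsFace c m m := by
  refine ⟨𝟙 m.1.1, fun _ => rfl, ?_, ?_, X.map_id_apply _ _⟩
  · exact (Set.eq_empty_of_forall_notMem fun i hi => by simp [hc] at hi).symm
  · exact (Set.eq_empty_of_forall_notMem fun i hi => by simp [hc] at hi).symm

theorem mem_range_iff_active {φ : m.1.1 ⟶ m'.1.1} (hA : φ.A = {i | c (m'.2 i) = .unstarted})
    (hB : φ.B = {i | c (m'.2 i) = .terminated}) (i : Fin m'.1.1.n) :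
    i ∈ Set.range φ.toFun ↔ c (m'.2 i) = .active := by
  rw [φ.mem_range_iff, hA, hB, Set.mem_ofPred_eq, Set.mem_ofPred_eq]
  cases c (m'.2 i) <;> simp

theorem IsFace.comp (hc : IsSubstate c c') (h : IsFace c m m') (k : IsFace c' m' m'') :
    IsFace c m m'' := by
  obtain ⟨φ, hφ, hA, hB, hX⟩ := h
  obtain ⟨ψ, hψ, kA, kB, kX⟩ := k
  have fibre_eq : ∀ s ≠ Status.active,
      ψ.toFun '' {j | c (m'.2 j) = s} ∪ {i | c' (m''.2 i) = s} = {i | c (m''.2 i) = s} := by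
    intro s hs
    ext i
    constructor
    · rintro (⟨j, hj, rfl⟩ | hi)
      · rwa [Set.mem_ofPred_eq, hψ]
      · rw [Set.mem_ofPred_eq] at hi ⊢
        exact (hc _ (by rwa [hi])).trans hi
    · intro hi
      by_cases ha : c' (m''.2 i) = .active
      · obtain ⟨j, rfl⟩ := (mem_range_iff_active kA kB i).2 ha
        exact Or.inl ⟨j, by rwa [Set.mem_ofPred_eq, hψ] at hi, rfl⟩
      · exact Or.inr ((hc _ ha).symm.trans hi)
  refine ⟨φ ≫ ψ, fun i => (hψ _).trans (hφ i), ?_, ?_, ?_⟩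
  · change ψ.toFun '' φ.A ∪ ψ.A = _
    rw [hA, kA, fibre_eq _ Status.noConfusion]
  · change ψ.toFun '' φ.B ∪ ψ.B = _
    rw [hB, kB, fibre_eq _ Status.noConfusion]
  · rw [op_comp, X.map_comp ψ.op φ.op, ← hX, ← kX]
    rfl

theorem exists_isFace (c : V → Status) (m : Marked X V)
    (hs : ∀ i ∈ m.1.1.src, c (m.2 i) ≠ .unstarted)
    (ht : ∀ i ∈ m.1.1.tgt, c (m.2 i) ≠ .terminated) : ∃ m', IsFace c m' m := by
  obtain ⟨U, φ, hA, hB⟩ := m.1.1.exists_hom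
    (A := {i | c (m.2 i) = .unstarted}) (B := {i | c (m.2 i) = .terminated})
    (Set.disjoint_left.2 fun i hi hi' => Status.noConfusion (hi.symm.trans hi'))
    (Set.disjoint_left.2 fun i hi h => hs i h hi) (Set.disjoint_left.2 fun i hi h => ht i h hi)
  exact ⟨⟨⟨U, X.map (Quiver.Hom.op (V := ILoSet Λ) φ) m.1.2⟩, fun i => m.2 (φ.toFun i)⟩,
    φ, fun _ => rfl, hA, hB, rfl⟩

theorem IsFace.of_comp (hc : IsSubstate c c') (h : IsFace c m m'') (k : IsFace c' m' m'') :
    IsFace c m m' := by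
  obtain ⟨n, hn⟩ : ∃ n, IsFace c n m' := by
    obtain ⟨φ, -, hA, hB, -⟩ := h
    obtain ⟨ψ, hψ, -, -, -⟩ := k
    refine exists_isFace c m' (fun i hi hu => ?_) fun i hi hu => ?_
    · exact Set.disjoint_left.1 φ.A_src (by rwa [hA, Set.mem_ofPred_eq, hψ]) ((ψ.src_iff i).2 hi)
    · exact Set.disjoint_left.1 φ.B_tgt (by rwa [hB, Set.mem_ofPred_eq, hψ]) ((ψ.tgt_iff i).2 hi)
  exact h.unique (hn.comp hc k) ▸ hn

end Face

variable {P Q : Iposet Λ} {σ τ σ' τ' : Set P.carrier} {c c' : P.carrier → Status}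
  {m m' : Marked X P.carrier}

/-- The events of `m` are the events of `P` that are active in `c`, in event order; `σ` and `τ` mark
the events in the interfaces of `m`. -/
structure Over (P : Iposet Λ) (σ τ : Set P.carrier) (c : P.carrier → Status)
    (m : Marked X P.carrier) : Prop where
  mono : ∀ i j, i < j → P.ev (m.2 i) (m.2 j)
  range : ∀ p, (∃ i, m.2 i = p) ↔ c p = .active
  label : ∀ i, P.label (m.2 i) = m.1.1.label i
  src : ∀ i, i ∈ m.1.1.src ↔ m.2 i ∈ σ
  tgt : ∀ i, i ∈ m.1.1.tgt ↔ m.2 i ∈ τ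

theorem Over.active (h : m.Over P σ τ c) (i : Fin m.1.1.n) : c (m.2 i) = .active :=
  (h.range _).1 ⟨i, rfl⟩

theorem Over.injective (h : m.Over P σ τ c) : Function.Injective m.2 :=
  Iposet.injective_of_ev h.mono

theorem Over.eq_of_fst_eq (h : m.Over P σ τ c) (h' : m'.Over P σ' τ' c) (hx : m.1 = m'.1) :
    m = m' := by
  obtain ⟨x, g⟩ := m
  obtain ⟨x', g'⟩ := m'
  dsimp only at hx
  subst hx
  have : IsStrictOrder P.carrier P.ev := { irrefl := P.ev_irrefl, trans := P.ev_trans }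
  let := partialOrderOfSO P.ev
  obtain rfl : g = g' := (StrictMono.range_inj (fun i j => h.mono i j) fun i j => h'.mono i j).1
    (Set.ext fun p => (h.range p).trans (h'.range p).symm)
  rfl

theorem Over.mem_src_iff (h : m.Over P σ τ c) (h' : m.Over P σ' τ' c) {p : P.carrier}
    (hp : c p = .active) : p ∈ σ ↔ p ∈ σ' := by
  obtain ⟨i, rfl⟩ := (h.range p).2 hp
  rw [← h.src, h'.src]

theorem Over.mem_tgt_iff (h : m.Over P σ τ c) (h' : m.Over P σ' τ' c) {p : P.carrier}
    (hp : c p = .active) : p ∈ τ ↔ p ∈ τ' := by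
  obtain ⟨i, rfl⟩ := (h.range p).2 hp
  rw [← h.tgt, h'.tgt]

theorem Over.of_isFace (h : m'.Over P σ τ c') (hf : IsFace c m m') (hc : IsSubstate c c') :
    m.Over P σ τ c := by
  obtain ⟨φ, hφ, hA, hB, -⟩ := hf
  refine ⟨fun i j hij => ?_, fun p => ⟨?_, fun hp => ?_⟩, fun i => ?_, fun i => ?_, fun i => ?_⟩
  · rw [← hφ, ← hφ]
    exact h.mono _ _ (φ.strictMono hij)
  · rintro ⟨i, rfl⟩
    rw [← hφ]
    exact (mem_range_iff_active hA hB (φ.toFun i)).1 ⟨i, rfl⟩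
  · have active : c' p = .active := by
      by_contra hn
      exact hn ((hc p hn).symm.trans hp)
    obtain ⟨j, rfl⟩ := (h.range p).2 active
    obtain ⟨i, rfl⟩ := (mem_range_iff_active hA hB j).2 hp
    exact ⟨i, (hφ i).symm⟩
  · rw [← hφ, h.label, φ.label_eq]
  · rw [← hφ, ← h.src, φ.src_iff]
  · rw [← hφ, ← h.tgt, φ.tgt_iff]

theorem Over.map {c : Q.carrier → Status} {σ' τ' : Set Q.carrier} {i : P.carrier → Q.carrier}
    (h : m.Over P σ τ (c ∘ i))
    (ev : ∀ a b, c (i a) = .active → c (i b) = .active → P.ev a b → Q.ev (i a) (i b))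
    (range : ∀ q, c q = .active → ∃ a, i a = q) (label : ∀ a, Q.label (i a) = P.label a)
    (src : ∀ a, c (i a) = .active → (i a ∈ σ' ↔ a ∈ σ))
    (tgt : ∀ a, c (i a) = .active → (i a ∈ τ' ↔ a ∈ τ)) :
    (m.map i).Over Q σ' τ' c := by
  refine ⟨fun k l hkl => ev _ _ (h.active k) (h.active l) (h.mono k l hkl),
    fun q => ⟨?_, fun hq => ?_⟩, fun k => (label _).trans (h.label k),
    fun k => (h.src k).trans (src _ (h.active k)).symm,
    fun k => (h.tgt k).trans (tgt _ (h.active k)).symm⟩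
  · rintro ⟨k, rfl⟩
    exact h.active k
  · obtain ⟨a, rfl⟩ := range q hq
    obtain ⟨k, rfl⟩ := (h.range a).2 hq
    exact ⟨k, rfl⟩

end Marked

end

/-! ## Realizations -/

section

variable {Λ : Type u} {X : IpcSet.{u, w} Λ} {P Q : Iposet Λ}

namespace Iposet

/-- The states of the events of `P` that may occur during an execution in which the events of `σ`
are started from the beginning and those of `τ` are never terminated. -/
structure Consistent (P : Iposet Λ) (σ τ : Set P.carrier) (c : P.carrier → Status) : Prop where
  prec : ∀ p q, P.lt p q → c q ≠ .unstarted → c p = .terminated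
  src : ∀ p ∈ σ, c p ≠ .unstarted
  tgt : ∀ p ∈ τ, c p ≠ .terminated

theorem Consistent.not_lt {σ τ : Set P.carrier} {c : P.carrier → Status} (hc : P.Consistent σ τ c)
    {p q : P.carrier} (hp : c p = .active) (hq : c q = .active) : ¬ P.lt p q := fun h =>
  Status.noConfusion (hp.symm.trans (hc.prec p q h (hq ▸ Status.noConfusion)))

theorem Consistent.comp {σ τ : Set P.carrier} {σ' τ' : Set Q.carrier} {c : Q.carrier → Status}
    (hc : Q.Consistent σ' τ' c) {i : P.carrier → Q.carrier}
    (lt : ∀ a b, P.lt a b → Q.lt (i a) (i b)) (src : ∀ a ∈ σ, i a ∈ σ')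
    (tgt : ∀ a ∈ τ, i a ∈ τ') : P.Consistent σ τ (c ∘ i) :=
  ⟨fun a b h => hc.prec _ _ (lt a b h), fun a h => hc.src _ (src a h),
    fun a h => hc.tgt _ (tgt a h)⟩

open Classical in
/-- The state at the beginning of an execution of `P`. -/
noncomputable def initial (P : Iposet Λ) (p : P.carrier) : Status :=
  if p ∈ P.S then .active else .unstarted

open Classical in
/-- The state at the end of an execution of `P`. -/
noncomputable def final (P : Iposet Λ) (p : P.carrier) : Status :=
  if p ∈ P.T then .active else .terminated

variable {p : P.carrier} {σ τ : Set P.carrier}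

theorem initial_eq_active_iff : P.initial p = .active ↔ p ∈ P.S := by
  by_cases h : p ∈ P.S <;> simp [initial, h]

theorem initial_eq_unstarted_iff : P.initial p = .unstarted ↔ p ∉ P.S := by
  by_cases h : p ∈ P.S <;> simp [initial, h]

theorem initial_ne_terminated : P.initial p ≠ .terminated := by
  by_cases h : p ∈ P.S <;> simp [initial, h]

theorem final_eq_active_iff : P.final p = .active ↔ p ∈ P.T := by
  by_cases h : p ∈ P.T <;> simp [final, h]

theorem final_eq_terminated_iff : P.final p = .terminated ↔ p ∉ P.T := by
  by_cases h : p ∈ P.T <;> simp [final, h]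

theorem final_ne_unstarted : P.final p ≠ .unstarted := by
  by_cases h : p ∈ P.T <;> simp [final, h]

open Classical in
theorem initial_comp {i : P.carrier → Q.carrier} (h : ∀ a, i a ∈ Q.S ↔ a ∈ P.S) :
    Q.initial ∘ i = P.initial :=
  funext fun a => if_congr (h a) rfl rfl

open Classical in
theorem final_comp {i : P.carrier → Q.carrier} (h : ∀ a, i a ∈ Q.T ↔ a ∈ P.T) :
    Q.final ∘ i = P.final :=
  funext fun a => if_congr (h a) rfl rfl

theorem consistent_initial (hσ : σ ⊆ P.S) : P.Consistent σ τ P.initial where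
  prec p q h hq := by
    by_cases hS : q ∈ P.S
    · exact absurd h (P.S_minimal q hS p)
    · exact absurd (initial_eq_unstarted_iff.2 hS) hq
  src p hp := by
    rw [initial_eq_active_iff.2 (hσ hp)]
    exact Status.noConfusion
  tgt _ _ := initial_ne_terminated

theorem consistent_final (hτ : τ ⊆ P.T) : P.Consistent σ τ P.final where
  prec p q h _ := final_eq_terminated_iff.2 fun hT => P.T_maximal p hT q h
  src _ _ := final_ne_unstarted
  tgt p hp := by
    rw [final_eq_active_iff.2 (hτ hp)]
    exact Status.noConfusion

theorem IsSubsumption.ev_iff {f : P.carrier ≃ Q.carrier} (hf : P.IsSubsumption Q f)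
    {x y : P.carrier} (hxy : ¬ P.lt x y) (hyx : ¬ P.lt y x) : Q.ev (f x) (f y) ↔ P.ev x y := by
  refine ⟨fun h => ?_, fun h => hf.preserves x y h hxy hyx⟩
  rcases P.comparable x y with e | e | e | e | e
  · rw [e] at h
    exact absurd h (Q.ev_irrefl _)
  · exact absurd e hxy
  · exact absurd e hyx
  · exact e
  · exact absurd (Q.ev_trans _ _ _ h (hf.preserves _ _ e hyx hxy)) (Q.ev_irrefl _)

end Iposet

/-- A realization of `P` in `X` from `x` to `y`: a compatible family of cells, one for each
consistent state of the events of `P`. It is a map to `X` from the cube complex of `P`. The values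
of `cell` at inconsistent states are irrelevant. -/
structure Realization (X : IpcSet.{u, w} Λ) (P : Iposet Λ) (x y : X.Cell) where
  /-- The events in the source interfaces of the cells. -/
  σ : Set P.carrier
  /-- The events in the target interfaces of the cells. -/
  τ : Set P.carrier
  σ_sub : σ ⊆ P.S
  τ_sub : τ ⊆ P.T
  cell : (P.carrier → Status) → Marked X P.carrier
  isOver : ∀ c, P.Consistent σ τ c → (cell c).Over P σ τ c
  isFace : ∀ c c', P.Consistent σ τ c → P.Consistent σ τ c' → IsSubstate c c' →
    (cell c).IsFace c (cell c')
  initial_fst : (cell P.initial).1 = x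
  final_fst : (cell P.final).1 = y

namespace Realization

variable {x y z : X.Cell}

theorem of_subsumed (R : Realization X Q x y) (h : P.Subsumed Q) :
    Nonempty (Realization X P x y) := by
  obtain ⟨f, hf⟩ := h
  have consistent : ∀ c, P.Consistent (f ⁻¹' R.σ) (f ⁻¹' R.τ) c →
      Q.Consistent R.σ R.τ (c ∘ f.symm) := fun c hc =>
    hc.comp (fun a b h => hf.reflects _ _ (by simpa using h)) (fun a ha => by simpa using ha)
      fun a ha => by simpa using ha
  refine ⟨⟨f ⁻¹' R.σ, f ⁻¹' R.τ, fun p hp => (hf.S_iff p).1 (R.σ_sub hp),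
    fun p hp => (hf.T_iff p).1 (R.τ_sub hp), fun c => (R.cell (c ∘ f.symm)).map f.symm,
    fun c hc => ?_, fun c c' hc hc' hs => ?_, ?_, ?_⟩⟩
  · refine (R.isOver _ (consistent c hc)).map (fun a b ha hb h => ?_)
      (fun p _ => ⟨f p, f.symm_apply_apply p⟩) (fun a => ?_) (fun a _ => by simp) fun a _ => by simp
    · exact (hf.ev_iff (hc.not_lt ha hb) (hc.not_lt hb ha)).1 (by simpa using h)
    · rw [← hf.label_eq, f.apply_symm_apply]
  · exact (R.isFace _ _ (consistent c hc) (consistent c' hc') fun q hq => hs _ hq).map f.symm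
  · change (R.cell (P.initial ∘ f.symm)).1 = x
    rw [Iposet.initial_comp fun q => by simp [← hf.S_iff], R.initial_fst]
  · change (R.cell (P.final ∘ f.symm)).1 = y
    rw [Iposet.final_comp fun q => by simp [← hf.T_iff], R.final_fst]

theorem of_isFace {u : X.Cell} {S T : Set (Fin u.1.n)} {m₀ m₁ : Marked X (Fin u.1.n)}
    (h₀ : m₀.IsFace (u.1.withInterfaces S T).toIposet.initial ⟨u, id⟩)
    (h₁ : m₁.IsFace (u.1.withInterfaces S T).toIposet.final ⟨u, id⟩) :
    Nonempty (Realization X (u.1.withInterfaces S T).toIposet m₀.1 m₁.1) := by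
  classical
  set P := (u.1.withInterfaces S T).toIposet
  let m : Marked X P.carrier := ⟨u, id⟩
  have exists_face : ∀ c, ∃ m', P.Consistent u.1.src u.1.tgt c → Marked.IsFace c m' m := by
    intro c
    by_cases hc : P.Consistent u.1.src u.1.tgt c
    · exact (Marked.exists_isFace c m hc.src hc.tgt).imp fun m' hm' _ => hm'
    · exact ⟨m, fun h => absurd h hc⟩
  choose F hF using exists_face
  have hσ : u.1.src ⊆ P.S := fun i hi => by
    by_contra hn
    obtain ⟨φ, -, hA, -⟩ := h₀
    exact Set.disjoint_left.1 φ.A_src (hA ▸ Iposet.initial_eq_unstarted_iff.2 hn) hi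
  have hτ : u.1.tgt ⊆ P.T := fun i hi => by
    by_contra hn
    obtain ⟨φ, -, -, hB, -⟩ := h₁
    exact Set.disjoint_left.1 φ.B_tgt (hB ▸ Iposet.final_eq_terminated_iff.2 hn) hi
  have isOver : m.Over P u.1.src u.1.tgt fun _ => .active :=
    ⟨fun i j h => h, fun p => ⟨fun _ => rfl, fun _ => ⟨p, rfl⟩⟩, fun _ => rfl, fun _ => Iff.rfl,
      fun _ => Iff.rfl⟩
  exact ⟨⟨u.1.src, u.1.tgt, hσ, hτ, F,
    fun c hc => isOver.of_isFace (hF c hc) fun p hp => absurd rfl hp,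
    fun c c' hc hc' hs => (hF c hc).of_comp hs (hF c' hc'),
    congrArg Sigma.fst ((hF _ (Iposet.consistent_initial hσ)).unique h₀),
    congrArg Sigma.fst ((hF _ (Iposet.consistent_final hτ)).unique h₁)⟩⟩

theorem of_cell (x : X.Cell) :
    Nonempty (Realization X (x.1.withInterfaces Set.univ Set.univ).toIposet x x) :=
  of_isFace (m₀ := ⟨x, id⟩) (m₁ := ⟨x, id⟩)
    (Marked.isFace_self fun p => Iposet.initial_eq_active_iff.2 (Set.mem_univ p))
    (Marked.isFace_self fun p => Iposet.final_eq_active_iff.2 (Set.mem_univ p))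

theorem of_step : (s : Step X x y) → Nonempty (Realization X s.ev x y)
  | .up φ hB h => by
    refine of_isFace (m₀ := ⟨x, φ.toFun⟩) (m₁ := ⟨y, id⟩) ⟨φ, fun _ => rfl, ?_, ?_, h⟩
      (Marked.isFace_self fun p => Iposet.final_eq_active_iff.2 (Set.mem_univ p))
    · exact Set.ext fun i => (Iposet.initial_eq_unstarted_iff.trans not_not).symm
    · exact hB.trans (Set.eq_empty_of_forall_notMem fun i => Iposet.initial_ne_terminated).symm
  | .down φ hA h => by
    refine of_isFace (m₀ := ⟨x, id⟩) (m₁ := ⟨y, φ.toFun⟩)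
      (Marked.isFace_self fun p => Iposet.initial_eq_active_iff.2 (Set.mem_univ p))
      ⟨φ, fun _ => rfl, ?_, ?_, h⟩
    · exact hA.trans (Set.eq_empty_of_forall_notMem fun i => Iposet.final_ne_unstarted).symm
    · exact Set.ext fun i => (Iposet.final_eq_terminated_iff.trans not_not).symm

end Realization

end

/-! ## Gluing compositions -/

section

variable {Λ : Type u} {X : IpcSet.{u, w} Λ} {P Q : Iposet Λ}

namespace Iposet.Matching

variable (f : P.Matching Q) {p p' : P.carrier} {q q' : Q.carrier} {a b : (P.glue Q f).carrier}

/-- The inclusion of the events of `P` into those of the gluing composition of `P` and `Q`. -/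
def inl (p : P.carrier) : (P.glue Q f).carrier := Sum.inl p

/-- The map from the events of `Q` to those of the gluing composition of `P` and `Q`. -/
noncomputable def inr (q : Q.carrier) : (P.glue Q f).carrier := P.glueInr Q f q

theorem inl_injective : Function.Injective f.inl := Sum.inl_injective

theorem inr_injective : Function.Injective f.inr := by
  intro x y (h : P.glueInr Q f x = P.glueInr Q f y)
  rcases P.glueInr_cases Q f x with ⟨t, rfl, ex⟩ | ⟨hx, ex⟩ <;>
    rcases P.glueInr_cases Q f y with ⟨s, rfl, ey⟩ | ⟨hy, ey⟩ <;> rw [ex, ey] at h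
  · rw [Subtype.ext (Sum.inl_injective h)]
  · cases h
  · cases h
  · exact congrArg Subtype.val (Sum.inr_injective h)

theorem inr_apply (t : P.T) : f.inr (f.1 t) = f.inl t := P.glueInr_mem Q f t

theorem exists_inr_eq_inl (hp : p ∈ P.T) : ∃ q ∈ Q.S, f.inr q = f.inl p :=
  ⟨f.1 ⟨p, hp⟩, (f.1 ⟨p, hp⟩).2, f.inr_apply ⟨p, hp⟩⟩

theorem exists_inl_eq_inr (hq : q ∈ Q.S) : ∃ p ∈ P.T, f.inl p = f.inr q :=
  ⟨f.1.symm ⟨q, hq⟩, (f.1.symm ⟨q, hq⟩).2, by simp [← inr_apply]⟩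

theorem mem_of_inr_eq_inl (h : f.inr q = f.inl p) : p ∈ P.T ∧ q ∈ Q.S := by
  have hq : q ∈ Q.S := by
    by_contra hq
    exact Sum.inr_ne_inl ((P.glueInr_notMem Q f q hq).symm.trans h)
  obtain ⟨p', hp', e⟩ := f.exists_inl_eq_inr hq
  exact ⟨f.inl_injective (e.trans h) ▸ hp', hq⟩

theorem eq_inl_or_eq_inr (a : (P.glue Q f).carrier) :
    (∃ p, a = f.inl p) ∨ ∃ q, q ∉ Q.S ∧ a = f.inr q := by
  rcases a with p | q
  · exact Or.inl ⟨p, rfl⟩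
  · exact Or.inr ⟨q.1, q.2, (P.glueInr_notMem Q f q.1 q.2).symm⟩

theorem eq_inl_or_eq_inr' (a : (P.glue Q f).carrier) :
    (∃ p ∉ P.T, a = f.inl p) ∨ ∃ q, a = f.inr q := by
  rcases f.eq_inl_or_eq_inr a with ⟨p, rfl⟩ | ⟨q, -, rfl⟩
  · by_cases hp : p ∈ P.T
    · obtain ⟨q, -, h⟩ := f.exists_inr_eq_inl hp
      exact Or.inr ⟨q, h.symm⟩
    · exact Or.inl ⟨p, hp, rfl⟩
  · exact Or.inr ⟨q, rfl⟩

theorem label_inl : (P.glue Q f).label (f.inl p) = P.label p := rfl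

theorem label_inr : (P.glue Q f).label (f.inr q) = Q.label q := by
  by_cases hq : q ∈ Q.S
  · obtain ⟨t, rfl⟩ : ∃ t : P.T, (f.1 t : Q.carrier) = q := ⟨f.1.symm ⟨q, hq⟩, by simp⟩
    rw [f.inr_apply, f.label_inl]
    exact (f.2 t).symm
  · exact congrArg (P.glue Q f).label (P.glueInr_notMem Q f q hq)

theorem inl_mem_S_iff : f.inl p ∈ (P.glue Q f).S ↔ p ∈ P.S := f.inl_injective.mem_set_image

theorem inr_mem_T_iff : f.inr q ∈ (P.glue Q f).T ↔ q ∈ Q.T := f.inr_injective.mem_set_image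

theorem lt_inl_iff : (P.glue Q f).lt (f.inl p) (f.inl p') ↔ P.lt p p' := P.glueLt_iff Q f _ _

theorem lt_inl_inr (hp : p ∉ P.T) (hq : q ∉ Q.S) : (P.glue Q f).lt (f.inl p) (f.inr q) :=
  GlueLt.cross p q hp hq

theorem lt_inr_iff : (P.glue Q f).lt (f.inr q) (f.inr q') ↔ Q.lt q q' := by
  refine ⟨fun h => ?_, GlueLt.right q q'⟩
  have h : P.GlueLtCases Q f (P.glueInr Q f q) (P.glueInr Q f q') := (P.glueLt_iff Q f _ _).1 h
  rcases P.glueInr_cases Q f q with ⟨t, rfl, ex⟩ | ⟨hx, ex⟩ <;>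
    rcases P.glueInr_cases Q f q' with ⟨s, rfl, ey⟩ | ⟨hy, ey⟩ <;> rw [ex, ey] at h
  · exact absurd h (P.T_maximal _ t.2 _)
  · rcases h with h | ⟨s, hs, h⟩
    · exact absurd t.2 h
    · rwa [Subtype.ext hs]
  · exact h.elim
  · exact h

theorem lt_cases (h : (P.glue Q f).lt a b) :
    (∃ p p', P.lt p p' ∧ a = f.inl p ∧ b = f.inl p') ∨
      (∃ q q', Q.lt q q' ∧ a = f.inr q ∧ b = f.inr q') ∨
      ∃ p q, p ∉ P.T ∧ q ∉ Q.S ∧ a = f.inl p ∧ b = f.inr q := by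
  rcases h with ⟨p, p', h⟩ | ⟨q, q', h⟩ | ⟨p, q, hp, hq⟩
  · exact Or.inl ⟨p, p', h, rfl, rfl⟩
  · exact Or.inr (Or.inl ⟨q, q', h, rfl, rfl⟩)
  · exact Or.inr (Or.inr ⟨p, q, hp, hq, rfl, rfl⟩)

theorem ev_inl_iff : (P.glue Q f).ev (f.inl p) (f.inl p') ↔ P.ev p p' :=
  ⟨fun h => P.glueEv_cases Q f _ _ h, fun h => .single (GlueEvBase.left p p' h)⟩

theorem ev_inr_iff : (P.glue Q f).ev (f.inr q) (f.inr q') ↔ Q.ev q q' := by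
  refine ⟨fun h => ?_, fun h => .single (GlueEvBase.right q q' h)⟩
  have h : P.GlueEvCases Q f (P.glueInr Q f q) (P.glueInr Q f q') := P.glueEv_cases Q f _ _ h
  rcases P.glueInr_cases Q f q with ⟨t, rfl, ex⟩ | ⟨hx, ex⟩ <;>
    rcases P.glueInr_cases Q f q' with ⟨s, rfl, ey⟩ | ⟨hy, ey⟩ <;> rw [ex, ey] at h
  · exact (f.ev_iff t s).2 h
  · obtain ⟨s, hs | hs, h⟩ := h
    · rwa [Subtype.ext hs]
    · exact Q.ev_trans _ _ _ ((f.ev_iff t s).2 hs) h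
  · obtain ⟨t, h, hs | hs⟩ := h
    · rwa [← Subtype.ext hs]
    · exact Q.ev_trans _ _ _ h ((f.ev_iff t s).2 hs)
  · exact h

/-- The event order of the gluing composition is a transitive closure, but for concurrent events no
transitive step is needed. -/
theorem ev_cases_of_not_lt (h : (P.glue Q f).ev a b) (hab : ¬ (P.glue Q f).lt a b)
    (hba : ¬ (P.glue Q f).lt b a) :
    (∃ p p', P.ev p p' ∧ a = f.inl p ∧ b = f.inl p') ∨
      ∃ q q', Q.ev q q' ∧ a = f.inr q ∧ b = f.inr q' := by
  rcases f.eq_inl_or_eq_inr a with ⟨p, rfl⟩ | ⟨q, hq, rfl⟩ <;>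
    rcases f.eq_inl_or_eq_inr b with ⟨p', rfl⟩ | ⟨q', hq', rfl⟩
  · exact Or.inl ⟨p, p', f.ev_inl_iff.1 h, rfl, rfl⟩
  · obtain ⟨q, -, e⟩ := f.exists_inr_eq_inl (by_contra fun hp => hab (f.lt_inl_inr hp hq'))
    rw [← e] at h ⊢
    exact Or.inr ⟨q, q', f.ev_inr_iff.1 h, rfl, rfl⟩
  · obtain ⟨q', -, e⟩ := f.exists_inr_eq_inl (by_contra fun hp => hba (f.lt_inl_inr hp hq))
    rw [← e] at h ⊢
    exact Or.inr ⟨q, q', f.ev_inr_iff.1 h, rfl, rfl⟩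
  · exact Or.inr ⟨q, q', f.ev_inr_iff.1 h, rfl, rfl⟩

end Iposet.Matching

end

section

variable {Λ : Type u} {X : IpcSet.{u, w} Λ} {P Q : Iposet Λ}

namespace Iposet.Matching

variable (f : P.Matching Q) {c c' : (P.glue Q f).carrier → Status}

/-- The state of `P.glue Q f` in which the execution of `P` is finished and that of `Q` has not
begun: the events of the common interface are active. -/
noncomputable def cut : (P.glue Q f).carrier → Status := Sum.elim P.final fun _ => .unstarted

theorem cut_comp_inr : f.cut ∘ f.inr = Q.initial := by
  funext q
  by_cases hq : q ∈ Q.S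
  · obtain ⟨p, hp, e⟩ := f.exists_inl_eq_inr hq
    rw [Function.comp_apply, ← e, Iposet.initial_eq_active_iff.2 hq]
    exact Iposet.final_eq_active_iff.2 hp
  · exact (congrArg f.cut (P.glueInr_notMem Q f q hq)).trans
      (Iposet.initial_eq_unstarted_iff.2 hq).symm

/-- The execution of `Q` has not begun. -/
def Early (c : (P.glue Q f).carrier → Status) : Prop := ∀ q ∉ Q.S, c (f.inr q) = .unstarted

/-- The execution of `P` is finished. -/
def Late (c : (P.glue Q f).carrier → Status) : Prop := ∀ p ∉ P.T, c (f.inl p) = .terminated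

variable {f}

theorem late_of_not_early {σ τ : Set (P.glue Q f).carrier} (hc : (P.glue Q f).Consistent σ τ c)
    (h : ¬ f.Early c) : f.Late c := by
  simp only [Early, not_forall] at h
  obtain ⟨q, hq, hne⟩ := h
  exact fun p hp => hc.prec _ _ (f.lt_inl_inr hp hq) hne

theorem Early.of_isSubstate (h : f.Early c') (hs : IsSubstate c c') : f.Early c := fun q hq => by
  rw [hs _ (by rw [h q hq]; exact Status.noConfusion), h q hq]

theorem Late.of_isSubstate (h : f.Late c') (hs : IsSubstate c c') : f.Late c := fun p hp => by
  rw [hs _ (by rw [h p hp]; exact Status.noConfusion), h p hp]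

theorem Early.isSubstate (h : f.Early c) : IsSubstate (c ∘ f.inr) Q.initial := fun q hq => by
  have hqS : q ∉ Q.S := fun hqS => hq (Iposet.initial_eq_active_iff.2 hqS)
  rw [Iposet.initial_eq_unstarted_iff.2 hqS]
  exact h q hqS

theorem Late.isSubstate (h : f.Late c) : IsSubstate (c ∘ f.inl) P.final := fun p hp => by
  have hpT : p ∉ P.T := fun hpT => hp (Iposet.final_eq_active_iff.2 hpT)
  rw [Iposet.final_eq_terminated_iff.2 hpT]
  exact h p hpT

theorem Early.exists_inl_eq (h : f.Early c) (a : (P.glue Q f).carrier) (ha : c a = .active) :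
    ∃ p, f.inl p = a := by
  rcases f.eq_inl_or_eq_inr a with ⟨p, rfl⟩ | ⟨q, hq, rfl⟩
  · exact ⟨p, rfl⟩
  · exact absurd (ha.symm.trans (h q hq)) Status.noConfusion

theorem Late.exists_inr_eq (h : f.Late c) (a : (P.glue Q f).carrier) (ha : c a = .active) :
    ∃ q, f.inr q = a := by
  rcases f.eq_inl_or_eq_inr a with ⟨p, rfl⟩ | ⟨q, -, rfl⟩
  · by_cases hp : p ∈ P.T
    · exact (f.exists_inr_eq_inl hp).imp fun q hq => hq.2
    · exact absurd (ha.symm.trans (h p hp)) Status.noConfusion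
  · exact ⟨q, rfl⟩

end Iposet.Matching

theorem Marked.Over.map_inl {f : P.Matching Q} {c : (P.glue Q f).carrier → Status}
    {m : Marked X P.carrier} {σ τ : Set P.carrier} {τ' : Set (P.glue Q f).carrier}
    (h : m.Over P σ τ (c ∘ f.inl)) (hc : f.Early c)
    (hτ : ∀ p, c (f.inl p) = .active → (f.inl p ∈ τ' ↔ p ∈ τ)) :
    (m.map f.inl).Over (P.glue Q f) (f.inl '' σ) τ' c :=
  h.map (fun _ _ _ _ => f.ev_inl_iff.2) hc.exists_inl_eq (fun _ => f.label_inl)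
    (fun _ _ => f.inl_injective.mem_set_image) hτ

theorem Marked.Over.map_inr {f : P.Matching Q} {c : (P.glue Q f).carrier → Status}
    {m : Marked X Q.carrier} {σ τ : Set Q.carrier} {σ' : Set (P.glue Q f).carrier}
    (h : m.Over Q σ τ (c ∘ f.inr)) (hc : f.Late c)
    (hσ : ∀ q, c (f.inr q) = .active → (f.inr q ∈ σ' ↔ q ∈ σ)) :
    (m.map f.inr).Over (P.glue Q f) σ' (f.inr '' τ) c :=
  h.map (fun _ _ _ _ => f.ev_inr_iff.2) hc.exists_inr_eq (fun _ => f.label_inr) hσ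
    (fun _ _ => f.inr_injective.mem_set_image)

namespace Realization

variable {x y z : X.Cell} (R₁ : Realization X P x z) (R₂ : Realization X Q z y) (f : P.Matching Q)

theorem over_cut_inl : ((R₁.cell P.final).map f.inl).Over (P.glue Q f) (f.inl '' R₁.σ)
    (f.inl '' R₁.τ) f.cut :=
  (R₁.isOver _ (Iposet.consistent_final R₁.τ_sub)).map_inl
    (fun _ hq => (congrFun f.cut_comp_inr _).trans (Iposet.initial_eq_unstarted_iff.2 hq))
    fun _ _ => f.inl_injective.mem_set_image

theorem over_cut_inr : ((R₂.cell Q.initial).map f.inr).Over (P.glue Q f) (f.inr '' R₂.σ)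
    (f.inr '' R₂.τ) f.cut := by
  refine Marked.Over.map_inr ?_ (fun _ hp => Iposet.final_eq_terminated_iff.2 hp)
    fun _ _ => f.inr_injective.mem_set_image
  rw [f.cut_comp_inr]
  exact R₂.isOver _ (Iposet.consistent_initial R₂.σ_sub)

theorem map_final_eq_map_initial :
    (R₁.cell P.final).map f.inl = (R₂.cell Q.initial).map f.inr :=
  (R₁.over_cut_inl f).eq_of_fst_eq (R₂.over_cut_inr f) (R₁.final_fst.trans R₂.initial_fst.symm)

variable {f}

theorem inr_mem_image_σ_iff {q : Q.carrier} : f.inr q ∈ f.inl '' R₁.σ ↔ q ∈ R₂.σ := by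
  by_cases hq : q ∈ Q.S
  · have active : f.cut (f.inr q) = .active :=
      (congrFun f.cut_comp_inr q).trans (Iposet.initial_eq_active_iff.2 hq)
    have isOver := R₂.over_cut_inr f
    rw [← R₁.map_final_eq_map_initial R₂ f] at isOver
    rw [(R₁.over_cut_inl f).mem_src_iff isOver active, f.inr_injective.mem_set_image]
  · refine iff_of_false ?_ fun h => hq (R₂.σ_sub h)
    rintro ⟨p, -, e⟩
    exact hq (f.mem_of_inr_eq_inl e.symm).2

theorem inl_mem_image_τ_iff {p : P.carrier} : f.inl p ∈ f.inr '' R₂.τ ↔ p ∈ R₁.τ := by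
  by_cases hp : p ∈ P.T
  · have active : f.cut (f.inl p) = .active := Iposet.final_eq_active_iff.2 hp
    have isOver := R₂.over_cut_inr f
    rw [← R₁.map_final_eq_map_initial R₂ f] at isOver
    rw [isOver.mem_tgt_iff (R₁.over_cut_inl f) active, f.inl_injective.mem_set_image]
  · refine iff_of_false ?_ fun h => hp (R₁.τ_sub h)
    rintro ⟨q, -, e⟩
    exact hp (f.mem_of_inr_eq_inl e).1

variable {c c' : (P.glue Q f).carrier → Status}

theorem consistent_comp_inl (hc : (P.glue Q f).Consistent (f.inl '' R₁.σ) (f.inr '' R₂.τ) c) :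
    P.Consistent R₁.σ R₁.τ (c ∘ f.inl) :=
  hc.comp (fun _ _ => f.lt_inl_iff.2) (fun _ => Set.mem_image_of_mem _)
    fun _ => (R₁.inl_mem_image_τ_iff R₂).2

theorem consistent_comp_inr (hc : (P.glue Q f).Consistent (f.inl '' R₁.σ) (f.inr '' R₂.τ) c) :
    Q.Consistent R₂.σ R₂.τ (c ∘ f.inr) :=
  hc.comp (fun _ _ => f.lt_inr_iff.2) (fun _ => (R₁.inr_mem_image_σ_iff R₂).2)
    fun _ => Set.mem_image_of_mem _

open Classical in
/-- The cells of the composite of two realizations. -/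
noncomputable def glueCell (f : P.Matching Q) (c : (P.glue Q f).carrier → Status) :
    Marked X (P.glue Q f).carrier :=
  if f.Early c then (R₁.cell (c ∘ f.inl)).map f.inl else (R₂.cell (c ∘ f.inr)).map f.inr

theorem glueCell_of_early (h : f.Early c) :
    R₁.glueCell R₂ f c = (R₁.cell (c ∘ f.inl)).map f.inl :=
  if_pos h

/-- A state that is both early and late is a substate of the cut, so both of its cells are the same
face of the common cell at the cut. -/
theorem glueCell_of_late (hc : (P.glue Q f).Consistent (f.inl '' R₁.σ) (f.inr '' R₂.τ) c)
    (h : f.Late c) : R₁.glueCell R₂ f c = (R₂.cell (c ∘ f.inr)).map f.inr := by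
  by_cases he : f.Early c
  · rw [R₁.glueCell_of_early R₂ he]
    have face₁ := (R₁.isFace _ _ (R₁.consistent_comp_inl R₂ hc)
      (Iposet.consistent_final R₁.τ_sub) h.isSubstate).map f.inl
    have face₂ := (R₂.isFace _ _ (R₁.consistent_comp_inr R₂ hc)
      (Iposet.consistent_initial R₂.σ_sub) he.isSubstate).map f.inr
    rw [R₁.map_final_eq_map_initial R₂ f] at face₁
    exact face₁.unique face₂
  · exact if_neg he

theorem over_glueCell (hc : (P.glue Q f).Consistent (f.inl '' R₁.σ) (f.inr '' R₂.τ) c) :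
    (R₁.glueCell R₂ f c).Over (P.glue Q f) (f.inl '' R₁.σ) (f.inr '' R₂.τ) c := by
  by_cases he : f.Early c
  · rw [R₁.glueCell_of_early R₂ he]
    exact (R₁.isOver _ (R₁.consistent_comp_inl R₂ hc)).map_inl he
      fun _ _ => R₁.inl_mem_image_τ_iff R₂
  · have hl := Iposet.Matching.late_of_not_early hc he
    rw [R₁.glueCell_of_late R₂ hc hl]
    exact (R₂.isOver _ (R₁.consistent_comp_inr R₂ hc)).map_inr hl
      fun _ _ => R₁.inr_mem_image_σ_iff R₂

theorem isFace_glueCell (hc : (P.glue Q f).Consistent (f.inl '' R₁.σ) (f.inr '' R₂.τ) c)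
    (hc' : (P.glue Q f).Consistent (f.inl '' R₁.σ) (f.inr '' R₂.τ) c') (hs : IsSubstate c c') :
    (R₁.glueCell R₂ f c).IsFace c (R₁.glueCell R₂ f c') := by
  by_cases he : f.Early c'
  · rw [R₁.glueCell_of_early R₂ (he.of_isSubstate hs), R₁.glueCell_of_early R₂ he]
    exact (R₁.isFace _ _ (R₁.consistent_comp_inl R₂ hc) (R₁.consistent_comp_inl R₂ hc')
      fun p => hs (f.inl p)).map f.inl
  · have hl := Iposet.Matching.late_of_not_early hc' he
    rw [R₁.glueCell_of_late R₂ hc (hl.of_isSubstate hs), R₁.glueCell_of_late R₂ hc' hl]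
    exact (R₂.isFace _ _ (R₁.consistent_comp_inr R₂ hc) (R₁.consistent_comp_inr R₂ hc')
      fun q => hs (f.inr q)).map f.inr

/-- The gluing composition of two realizations. -/
noncomputable def glue (f : P.Matching Q) : Realization X (P.glue Q f) x y where
  σ := f.inl '' R₁.σ
  τ := f.inr '' R₂.τ
  σ_sub := Set.image_mono R₁.σ_sub
  τ_sub := Set.image_mono R₂.τ_sub
  cell := R₁.glueCell R₂ f
  isOver _ := R₁.over_glueCell R₂
  isFace _ _ := R₁.isFace_glueCell R₂
  initial_fst := by
    rw [R₁.glueCell_of_early R₂, Iposet.initial_comp fun _ => f.inl_mem_S_iff]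
    · exact R₁.initial_fst
    · refine fun q hq => Iposet.initial_eq_unstarted_iff.2 ?_
      rintro ⟨p, -, e⟩
      exact hq (f.mem_of_inr_eq_inl e.symm).2
  final_fst := by
    rw [R₁.glueCell_of_late R₂, Iposet.final_comp fun _ => f.inr_mem_T_iff]
    · exact R₂.final_fst
    · exact Iposet.consistent_final (Set.image_mono R₂.τ_sub)
    · refine fun p hp => Iposet.final_eq_terminated_iff.2 ?_
      rintro ⟨q, -, e⟩
      exact hp (f.mem_of_inr_eq_inl e).1

end Realization

end

/-! ## Embeddings into gluing compositions -/

section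

variable {Λ : Type u} {P Q R G : Iposet Λ}

theorem LoIso.eq_of_total {α β : Type} [Finite α] {r : α → α → Prop} {l : α → Λ}
    {s : β → β → Prop} {m : β → Λ} (irrefl : ∀ x, ¬ r x x) (trans : ∀ x y z, r x y → r y z → r x z)
    (total : ∀ x y, ¬ r x y → ¬ r y x → x = y) (f g : LoIso r l s m) (x : α) :
    f.1 x = g.1 x := by
  have : Std.Irrefl r := ⟨irrefl⟩
  have : IsTrans α r := ⟨trans⟩
  have : IsWellFounded α r := ⟨Finite.wellFounded_of_trans_of_irrefl r⟩
  have : Std.Irrefl s := ⟨fun y h => irrefl (f.1.symm y) (f.1.symm.map_rel_iff.2 h)⟩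
  have : Std.Trichotomous s := ⟨fun a b h k => f.1.symm.injective
    (total _ _ (fun h' => h (f.1.symm.map_rel_iff.1 h')) fun h' => k (f.1.symm.map_rel_iff.1 h'))⟩
  have : f.1.toInitialSeg = g.1.toInitialSeg := Subsingleton.elim _ _
  exact DFunLike.congr_fun this x

namespace Iposet

theorem Matching.unique (f g : P.Matching Q) (t : P.T) : f.1 t = g.1 t := by
  have := P.finite
  refine LoIso.eq_of_total (r := fun x y : P.T => P.ev x y) (fun x => P.ev_irrefl x)
    (fun x y z => P.ev_trans x y z) (fun x y h k => ?_) f g t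
  rcases P.comparable x y with e | e | e | e | e
  · exact Subtype.ext e
  · exact absurd e (P.T_maximal _ x.2 _)
  · exact absurd e (P.T_maximal _ y.2 _)
  · exact absurd e h
  · exact absurd e k

/-- A map that identifies `P` with a set of events of `G` on which `G` has at most the precedence
of `P`: a subsumption onto its image that ignores interfaces. -/
structure IsWeakEmbedding (P G : Iposet Λ) (i : P.carrier → G.carrier) : Prop where
  injective : Function.Injective i
  label_eq : ∀ a, G.label (i a) = P.label a
  reflects : ∀ a b, G.lt (i a) (i b) → P.lt a b
  preserves : ∀ a b, P.ev a b → ¬ P.lt a b → ¬ P.lt b a → G.ev (i a) (i b)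

theorem IsSubsumption.isWeakEmbedding {e : P.carrier ≃ Q.carrier} (h : P.IsSubsumption Q e) :
    P.IsWeakEmbedding Q e :=
  ⟨e.injective, h.label_eq, h.reflects, h.preserves⟩

theorem Matching.isWeakEmbedding_inl (f : P.Matching Q) : P.IsWeakEmbedding (P.glue Q f) f.inl :=
  ⟨f.inl_injective, fun _ => f.label_inl, fun _ _ => f.lt_inl_iff.1,
    fun _ _ h _ _ => f.ev_inl_iff.2 h⟩

theorem Matching.isWeakEmbedding_inr (f : P.Matching Q) : Q.IsWeakEmbedding (P.glue Q f) f.inr :=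
  ⟨f.inr_injective, fun _ => f.label_inr, fun _ _ => f.lt_inr_iff.1,
    fun _ _ h _ _ => f.ev_inr_iff.2 h⟩

namespace IsWeakEmbedding

variable {i : P.carrier → G.carrier}

theorem comp {j : G.carrier → R.carrier} (hj : G.IsWeakEmbedding R j)
    (hi : P.IsWeakEmbedding G i) : P.IsWeakEmbedding R (j ∘ i) where
  injective := hj.injective.comp hi.injective
  label_eq a := (hj.label_eq _).trans (hi.label_eq a)
  reflects a b h := hi.reflects a b (hj.reflects _ _ h)
  preserves a b h hab hba := hj.preserves _ _ (hi.preserves a b h hab hba)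
    (fun k => hab (hi.reflects a b k)) fun k => hba (hi.reflects b a k)

variable (h : P.IsWeakEmbedding G i) (surj : Function.Surjective i) (hS : G.S = i '' P.S)
  (hT : G.T = i '' P.T)

include hS hT in
theorem isSubsumption : P.IsSubsumption G (Equiv.ofBijective i ⟨h.injective, surj⟩) where
  label_eq := h.label_eq
  S_iff a := by
    rw [hS]
    exact h.injective.mem_set_image
  T_iff a := by
    rw [hT]
    exact h.injective.mem_set_image
  reflects := h.reflects
  preserves := h.preserves

include h surj hS hT

theorem subsumed : P.Subsumed G := ⟨_, h.isSubsumption surj hS hT⟩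

theorem isomorphic (lt : ∀ a b, P.lt a b → G.lt (i a) (i b)) : P.Isomorphic G :=
  ⟨_, h.isSubsumption surj hS hT, fun a b => ⟨lt a b, h.reflects a b⟩⟩

end IsWeakEmbedding

namespace Matching

variable {i : P.carrier → G.carrier} {j : Q.carrier → G.carrier} {f : P.Matching Q}

theorem inl_ne_inr {p : P.carrier} {q : Q.carrier} (hq : q ∉ Q.S) : f.inl p ≠ f.inr q := fun e =>
  hq (f.mem_of_inr_eq_inl e.symm).2

theorem not_lt_inr_inl {p : P.carrier} {q : Q.carrier} :
    ¬ (P.glue Q f).lt (f.inr q) (f.inl p) := fun h => by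
  rcases f.lt_cases h with ⟨p₁, _, h, e, -⟩ | ⟨_, q₂, h, -, e⟩ | ⟨_, _, -, hq, -, e⟩
  · exact P.T_maximal p₁ (f.mem_of_inr_eq_inl e).1 _ h
  · exact Q.S_minimal q₂ (f.mem_of_inr_eq_inl e.symm).2 _ h
  · exact inl_ne_inr hq e

variable (f) in
/-- The map out of a gluing composition that is `i` on the events of `P` and `j` on those of `Q`.
It is `j` also on the common interface if `i` and `j` agree there. -/
def desc (i : P.carrier → G.carrier) (j : Q.carrier → G.carrier) :
    (P.glue Q f).carrier → G.carrier :=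
  Sum.elim i fun q => j q.1

variable (compat : ∀ t : P.T, j (f.1 t) = i t)

include compat

theorem desc_inr (q : Q.carrier) : f.desc i j (f.inr q) = j q := by
  rcases P.glueInr_cases Q f q with ⟨t, rfl, e⟩ | ⟨hq, e⟩
  · exact (congrArg (f.desc i j) e).trans (compat t).symm
  · exact congrArg (f.desc i j) e

theorem desc_surjective (h : ∀ a, (∃ p, i p = a) ∨ ∃ q, j q = a) :
    Function.Surjective (f.desc i j) := fun a => by
  rcases h a with ⟨p, rfl⟩ | ⟨q, rfl⟩
  · exact ⟨f.inl p, rfl⟩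
  · exact ⟨f.inr q, desc_inr compat q⟩

theorem desc_image_T (h : G.T = j '' Q.T) : G.T = f.desc i j '' (P.glue Q f).T := by
  change _ = f.desc i j '' (f.inr '' Q.T)
  rw [h, Set.image_image]
  exact Set.image_congr fun q _ => (desc_inr compat q).symm

theorem desc_lt (hi : ∀ p p', P.lt p p' → G.lt (i p) (i p'))
    (hj : ∀ q q', Q.lt q q' → G.lt (j q) (j q')) (cross : ∀ p ∉ P.T, ∀ q ∉ Q.S, G.lt (i p) (j q))
    (a b : (P.glue Q f).carrier) (h : (P.glue Q f).lt a b) :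
    G.lt (f.desc i j a) (f.desc i j b) := by
  rcases f.lt_cases h with
    ⟨p, p', lt, rfl, rfl⟩ | ⟨q, q', lt, rfl, rfl⟩ | ⟨p, q, hp, hq, rfl, rfl⟩
  · exact hi p p' lt
  · rw [desc_inr compat, desc_inr compat]
    exact hj q q' lt
  · rw [desc_inr compat]
    exact cross p hp q hq

theorem isWeakEmbedding_desc (hi : P.IsWeakEmbedding G i) (hj : Q.IsWeakEmbedding G j)
    (ne : ∀ p, ∀ q ∉ Q.S, i p ≠ j q) (not_lt : ∀ p, ∀ q ∉ Q.S, ¬ G.lt (j q) (i p)) :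
    (P.glue Q f).IsWeakEmbedding G (f.desc i j) := by
  have inr := desc_inr compat
  refine ⟨fun a b => ?_, fun a => ?_, fun a b h => ?_, fun a b h hab hba => ?_⟩
  · rcases f.eq_inl_or_eq_inr a with ⟨p, rfl⟩ | ⟨q, hq, rfl⟩ <;>
      rcases f.eq_inl_or_eq_inr b with ⟨p', rfl⟩ | ⟨q', hq', rfl⟩ <;> intro e
    · exact congrArg f.inl (hi.injective e)
    · exact absurd (e.trans (inr q')) (ne p q' hq')
    · exact absurd (e.symm.trans (inr q)) (ne p' q hq)
    · exact congrArg f.inr (hj.injective ((inr q).symm.trans (e.trans (inr q'))))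
  · rcases f.eq_inl_or_eq_inr a with ⟨p, rfl⟩ | ⟨q, -, rfl⟩
    · exact hi.label_eq p
    · rw [inr, hj.label_eq, f.label_inr]
  · rcases f.eq_inl_or_eq_inr a with ⟨p, rfl⟩ | ⟨q, hq, rfl⟩ <;>
      rcases f.eq_inl_or_eq_inr b with ⟨p', rfl⟩ | ⟨q', hq', rfl⟩
    · exact f.lt_inl_iff.2 (hi.reflects p p' h)
    · by_cases hp : p ∈ P.T
      · obtain ⟨q, -, e⟩ := f.exists_inr_eq_inl hp
        rw [← e, inr, inr] at h
        exact e ▸ f.lt_inr_iff.2 (hj.reflects q q' h)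
      · exact f.lt_inl_inr hp hq'
    · rw [inr] at h
      exact absurd h (not_lt p' q hq)
    · rw [inr, inr] at h
      exact f.lt_inr_iff.2 (hj.reflects q q' h)
  · rcases f.ev_cases_of_not_lt h hab hba with ⟨p, p', ev, rfl, rfl⟩ | ⟨q, q', ev, rfl, rfl⟩
    · exact hi.preserves p p' ev (mt f.lt_inl_iff.2 hab) (mt f.lt_inl_iff.2 hba)
    · rw [inr, inr]
      exact hj.preserves q q' ev (mt f.lt_inr_iff.2 hab) (mt f.lt_inr_iff.2 hba)

end Matching

theorem Matching.desc_image_S {f : P.Matching Q} {i : P.carrier → G.carrier}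
    {j : Q.carrier → G.carrier} (h : G.S = i '' P.S) : G.S = f.desc i j '' (P.glue Q f).S :=
  h.trans (Set.image_image (f.desc i j) f.inl P.S).symm

/-- A subsumption identifies the source interfaces. -/
def IsSubsumption.srcIso {e : P.carrier ≃ Q.carrier} (h : P.IsSubsumption Q e) :
    LoIso (fun x y : P.S => P.ev x y) (fun x : P.S => P.label x)
      (fun x y : Q.S => Q.ev x y) (fun x : Q.S => Q.label x) :=
  ⟨⟨e.subtypeEquiv fun x => (h.S_iff x).symm, fun {x y} =>
    h.ev_iff (P.S_minimal _ y.2 _) (P.S_minimal _ x.2 _)⟩, fun x => h.label_eq x⟩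

section GlueRight

variable {Q' : Iposet Λ} {e : Q.carrier ≃ Q'.carrier} (h : Q.IsSubsumption Q' e)
  (f : P.Matching Q) (f' : P.Matching Q')

include h

theorem IsSubsumption.inr_apply_eq_inl (t : P.T) : f'.inr (e (f.1 t)) = f'.inl t :=
  (congrArg (fun q : Q'.S => f'.inr q) (Matching.unique (f.trans h.srcIso) f' t)).trans
    (f'.inr_apply t)

theorem IsSubsumption.exists_isSubsumption_glue :
    ∃ k : (P.glue Q f).carrier ≃ (P.glue Q' f').carrier,
      (P.glue Q f).IsSubsumption (P.glue Q' f') k ∧ ⇑k = f.desc f'.inl (f'.inr ∘ e) := by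
  have compat := h.inr_apply_eq_inl f f'
  have notMem : ∀ q ∉ Q.S, e q ∉ Q'.S := fun q hq => mt (h.S_iff q).1 hq
  have embedding := Matching.isWeakEmbedding_desc compat f'.isWeakEmbedding_inl
    (f'.isWeakEmbedding_inr.comp h.isWeakEmbedding)
    (fun _ q hq => Matching.inl_ne_inr (notMem q hq))
    fun _ _ _ => Matching.not_lt_inr_inl
  refine ⟨_, embedding.isSubsumption (Matching.desc_surjective compat fun a => ?_)
    (Matching.desc_image_S rfl) (Matching.desc_image_T compat ?_), rfl⟩
  · rcases f'.eq_inl_or_eq_inr a with ⟨p, rfl⟩ | ⟨q, -, rfl⟩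
    · exact Or.inl ⟨p, rfl⟩
    · exact Or.inr ⟨e.symm q, congrArg f'.inr (e.apply_symm_apply q)⟩
  · have : Q'.T = e '' Q.T := by
      ext q
      rw [e.image_eq_preimage_symm, Set.mem_preimage, ← h.T_iff, e.apply_symm_apply]
    rw [Set.image_comp, ← this]
    rfl

end GlueRight

theorem Subsumed.glue_right {Q' : Iposet Λ} (h : Q.Subsumed Q') (f : P.Matching Q)
    (f' : P.Matching Q') : (P.glue Q f).Subsumed (P.glue Q' f') :=
  let ⟨_, he⟩ := h
  let ⟨_, hk, _⟩ := he.exists_isSubsumption_glue f f'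
  ⟨_, hk⟩

theorem Isomorphic.glue_right {Q' : Iposet Λ} (h : Q.Isomorphic Q') (f : P.Matching Q)
    (f' : P.Matching Q') : (P.glue Q f).Isomorphic (P.glue Q' f') := by
  obtain ⟨e, he, lt_iff⟩ := h
  obtain ⟨k, hk, k_eq⟩ := he.exists_isSubsumption_glue f f'
  refine ⟨k, hk, fun a b => ⟨?_, hk.reflects a b⟩⟩
  rw [k_eq]
  exact Matching.desc_lt (he.inr_apply_eq_inl f f') (fun _ _ => f'.lt_inl_iff.2)
    (fun q q' h => f'.lt_inr_iff.2 ((lt_iff q q').1 h))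
    (fun p hp q hq => f'.lt_inl_inr hp (mt (he.S_iff q).1 hq)) a b

/-- The target interface of a gluing composition. -/
noncomputable def glueTgtIso (P Q : Iposet Λ) (f : P.Matching Q) :
    LoIso (fun x y : Q.T => Q.ev x y) (fun x : Q.T => Q.label x)
      (fun x y : (P.glue Q f).T => (P.glue Q f).ev x y)
      (fun x : (P.glue Q f).T => (P.glue Q f).label x) :=
  ⟨⟨Equiv.Set.image f.inr Q.T f.inr_injective, f.ev_inr_iff⟩, fun _ => f.label_inr⟩

theorem glue_assoc_subsumed {g : Q.Matching R} {f : P.Matching (Q.glue R g)} {f' : P.Matching Q}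
    {g' : (P.glue Q f').Matching R}
    (hf : ∀ t : P.T, (f.1 t : (Q.glue R g).carrier) = g.inl (f'.1 t))
    (hg : ∀ t : Q.T, g'.inr (g.1 t) = g'.inl (f'.inr t)) :
    (P.glue (Q.glue R g) f).Subsumed ((P.glue Q f').glue R g') := by
  let j := g.desc (g'.inl ∘ f'.inr) g'.inr
  have j_inr : ∀ r, j (g.inr r) = g'.inr r := Matching.desc_inr hg
  have hj : (Q.glue R g).IsWeakEmbedding _ j :=
    Matching.isWeakEmbedding_desc hg (g'.isWeakEmbedding_inl.comp f'.isWeakEmbedding_inr)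
      g'.isWeakEmbedding_inr (fun _ _ => Matching.inl_ne_inr) fun _ _ _ => Matching.not_lt_inr_inl
  have compat (t : P.T) : j (f.1 t) = (g'.inl ∘ f'.inl) t := by
    rw [hf]
    exact congrArg g'.inl (f'.inr_apply t)
  have embedding := Matching.isWeakEmbedding_desc compat
    (g'.isWeakEmbedding_inl.comp f'.isWeakEmbedding_inl) hj ?ne ?not_lt
  case ne =>
    intro p w hw
    rcases g.eq_inl_or_eq_inr w with ⟨q, rfl⟩ | ⟨r, hr, rfl⟩
    · exact g'.inl_injective.ne (Matching.inl_ne_inr (mt g.inl_mem_S_iff.2 hw))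
    · exact j_inr r ▸ Matching.inl_ne_inr hr
  case not_lt =>
    intro p w hw
    rcases g.eq_inl_or_eq_inr w with ⟨q, rfl⟩ | ⟨r, -, rfl⟩
    · exact mt g'.lt_inl_iff.1 Matching.not_lt_inr_inl
    · exact j_inr r ▸ Matching.not_lt_inr_inl
  refine embedding.subsumed (Matching.desc_surjective compat fun a => ?_)
    (Matching.desc_image_S (Set.image_image g'.inl f'.inl P.S)) (Matching.desc_image_T compat ?_)
  · rcases g'.eq_inl_or_eq_inr a with ⟨b, rfl⟩ | ⟨r, -, rfl⟩
    · rcases f'.eq_inl_or_eq_inr b with ⟨p, rfl⟩ | ⟨q, -, rfl⟩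
      · exact Or.inl ⟨p, rfl⟩
      · exact Or.inr ⟨g.inl q, rfl⟩
    · exact Or.inr ⟨g.inr r, j_inr r⟩
  · change g'.inr '' R.T = j '' (g.inr '' R.T)
    rw [Set.image_image]
    exact Set.image_congr fun r _ => (j_inr r).symm

theorem exists_glue_assoc_subsumed (g : Q.Matching R) (f : P.Matching (Q.glue R g)) :
    ∃ (f' : P.Matching Q) (g' : (P.glue Q f').Matching R),
      (P.glue (Q.glue R g) f).Subsumed ((P.glue Q f').glue R g') := by
  let f' : P.Matching Q := f.trans (Q.glueSrcIso R g).symm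
  let g' : (P.glue Q f').Matching R := (P.glueTgtIso Q f').symm.trans g
  refine ⟨f', g', glue_assoc_subsumed (fun t => ?_) fun t => ?_⟩
  · exact congrArg Subtype.val ((Q.glueSrcIso R g).1.apply_symm_apply (f.1 t)).symm
  · rw [← g'.inr_apply ⟨f'.inr t, t.1, t.2, rfl⟩]
    exact congrArg (fun s => g'.inr (g.1 s)) ((P.glueTgtIso Q f').1.symm_apply_apply t).symm

end Iposet

end

section

variable {Λ : Type u} {P Q : Iposet Λ}

namespace Iposet.IsInterval

theorem exists_neg (h : P.IsInterval) : ∃ b e : P.carrier → ℝ,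
    (∀ x, b x ≤ e x) ∧ (∀ x y, P.lt x y ↔ e x < b y) ∧ ∀ x, e x < 0 := by
  obtain ⟨b, e, le, lt_iff⟩ := h
  exact ⟨fun x => -Real.exp (-b x), fun x => -Real.exp (-e x), by simpa using le,
    by simpa using lt_iff, fun x => neg_lt_zero.2 (Real.exp_pos _)⟩

theorem exists_pos (h : P.IsInterval) : ∃ b e : P.carrier → ℝ,
    (∀ x, b x ≤ e x) ∧ (∀ x y, P.lt x y ↔ e x < b y) ∧ ∀ x, 0 < b x := by
  obtain ⟨b, e, le, lt_iff⟩ := h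
  exact ⟨fun x => Real.exp (b x), fun x => Real.exp (e x), by simpa using le,
    by simpa using lt_iff, fun x => Real.exp_pos _⟩

/-- The intervals of `P` are put to the left of zero and those of `Q` to the right; an event of the
common interface begins with `P` and ends with `Q`. -/
theorem glue (hP : P.IsInterval) (hQ : Q.IsInterval) (f : P.Matching Q) :
    (P.glue Q f).IsInterval := by
  classical
  obtain ⟨b, e, le, lt_iff, neg⟩ := hP.exists_neg
  obtain ⟨b', e', le', lt_iff', pos⟩ := hQ.exists_pos
  have b_lt_e' (p : P.carrier) (q : Q.carrier) : b p < e' q :=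
    (le p).trans_lt ((neg p).trans ((pos q).trans_le (le' q)))
  let B : (P.glue Q f).carrier → ℝ := Sum.elim b fun q => b' q.1
  let E : (P.glue Q f).carrier → ℝ :=
    Sum.elim (fun p => if h : p ∈ P.T then e' (f.1 ⟨p, h⟩) else e p) fun q => e' q.1
  have B_inr {q} (hq : q ∉ Q.S) : B (f.inr q) = b' q := congrArg B (P.glueInr_notMem Q f q hq)
  have E_inl {p} (hp : p ∉ P.T) : E (f.inl p) = e p := dif_neg hp
  have E_inr (q) : E (f.inr q) = e' q := by
    rcases P.glueInr_cases Q f q with ⟨t, rfl, h⟩ | ⟨hq, h⟩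
    · exact (congrArg E h).trans (dif_pos t.2)
    · exact congrArg E h
  refine ⟨B, E, fun a => ?_, fun a c => ?_⟩
  · rcases f.eq_inl_or_eq_inr a with ⟨p, rfl⟩ | ⟨q, hq, rfl⟩
    · by_cases hp : p ∈ P.T
      · obtain ⟨q, -, h⟩ := f.exists_inr_eq_inl hp
        exact (b_lt_e' p q).le.trans_eq ((E_inr q).symm.trans (congrArg E h))
      · exact (le p).trans_eq (E_inl hp).symm
    · exact (B_inr hq).trans_le ((le' q).trans_eq (E_inr q).symm)
  · rcases f.eq_inl_or_eq_inr' a with ⟨p, hp, rfl⟩ | ⟨q, rfl⟩ <;>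
      rcases f.eq_inl_or_eq_inr c with ⟨p', rfl⟩ | ⟨q', hq', rfl⟩
    · rw [f.lt_inl_iff, E_inl hp, lt_iff]
      rfl
    · rw [E_inl hp, B_inr hq']
      exact iff_of_true (f.lt_inl_inr hp hq') ((neg p).trans (pos q'))
    · rw [E_inr]
      exact iff_of_false Matching.not_lt_inr_inl (b_lt_e' p' q).not_gt
    · rw [f.lt_inr_iff, E_inr, B_inr hq', lt_iff']

end Iposet.IsInterval

end

/-! ## Reading off a path from a realization -/

section

variable {Λ : Type u} {X : IpcSet.{u, w} Λ} {P : Iposet Λ} {x y : X.Cell} {σ τ : Set P.carrier}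
  {c c' : P.carrier → Status}

/-- The matching of an ilo-set with an iposet given by an enumeration of the source interface. -/
noncomputable def ILoSet.matching (V : ILoSet Λ) (Q : Iposet Λ) (g : V.tgt → Q.S)
    (surj : Function.Surjective g) (mono : ∀ i j : V.tgt, i < j → Q.ev (g i) (g j))
    (label : ∀ i, Q.label (g i) = V.label i) : V.toIposet.Matching Q :=
  ⟨⟨Equiv.ofBijective g ⟨.of_comp (Iposet.injective_of_ev (i := fun a => (g a : Q.carrier)) mono),
    surj⟩, Iposet.ev_iff_lt_of_ev (i := fun a => (g a : Q.carrier)) mono⟩, label⟩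

namespace Iposet

theorem Consistent.mono {σ' τ' : Set P.carrier} (hc : P.Consistent σ τ c) (hσ : σ' ⊆ σ)
    (hτ : τ' ⊆ τ) : P.Consistent σ' τ' c :=
  hc.comp (i := id) (fun _ _ h => h) hσ hτ

/-- The remainder of `P` after the state `c`: the terminated events are removed, and the active ones
form the source interface. -/
def rest (P : Iposet Λ) {c : P.carrier → Status} (hc : P.Consistent P.S P.T c) : Iposet Λ where
  carrier := {p // c p ≠ .terminated}
  finite := have := P.finite; inferInstance
  lt p q := P.lt p q
  ev p q := P.ev p q
  lt_irrefl p := P.lt_irrefl p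
  lt_trans p q r := P.lt_trans p q r
  ev_irrefl p := P.ev_irrefl p
  ev_trans p q r := P.ev_trans p q r
  comparable p q := by
    rw [Subtype.ext_iff]
    exact P.comparable p q
  label p := P.label p
  S := {p | c p = .active}
  T := {p | p.1 ∈ P.T}
  S_minimal p hp q h := q.2 (hc.prec q p h (hp ▸ Status.noConfusion))
  T_maximal p hp q := P.T_maximal p hp q

variable {hc : P.Consistent P.S P.T c} {d : (P.rest hc).carrier → Status}

namespace Consistent

theorem unstarted_of_notMem_rest_S {p : (P.rest hc).carrier} (hp : p ∉ (P.rest hc).S) :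
    c p.1 = .unstarted := by
  rcases h : c p.1
  exacts [rfl, absurd h hp, absurd h p.2]

open Classical in
/-- The state of `P` that corresponds to a state of its remainder after `c`. -/
noncomputable def resume (hc : P.Consistent P.S P.T c) (d : (P.rest hc).carrier → Status)
    (p : P.carrier) : Status :=
  if h : c p = .terminated then .terminated else d ⟨p, h⟩

theorem resume_of_terminated {p : P.carrier} (h : c p = .terminated) :
    hc.resume d p = .terminated :=
  dif_pos h

theorem resume_of_ne {p : P.carrier} (h : c p ≠ .terminated) : hc.resume d p = d ⟨p, h⟩ :=
  dif_neg h

theorem resume_comp_val : hc.resume d ∘ Subtype.val = d := funext fun p => resume_of_ne p.2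

theorem resume_eq (h : ∀ p, c p = .terminated → c' p = .terminated) (hd : d = c' ∘ Subtype.val) :
    hc.resume d = c' := by
  funext p
  by_cases hp : c p = .terminated
  · rw [resume_of_terminated hp, h p hp]
  · exact (resume_of_ne hp).trans (congrFun hd ⟨p, hp⟩)

theorem resume_initial : hc.resume (P.rest hc).initial = c :=
  resume_eq (fun _ h => h) <| funext fun p => by
    by_cases hp : p ∈ (P.rest hc).S
    · exact (initial_eq_active_iff.2 hp).trans (Eq.symm hp)
    · exact (initial_eq_unstarted_iff.2 hp).trans (unstarted_of_notMem_rest_S hp).symm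

theorem resume_final : hc.resume (P.rest hc).final = P.final :=
  resume_eq (fun p h => final_eq_terminated_iff.2 fun hp => hc.tgt p hp h) rfl

theorem consistent_resume (hτ : τ ⊆ P.T)
    (hd : (P.rest hc).Consistent (Subtype.val ⁻¹' σ) (Subtype.val ⁻¹' τ) d) :
    P.Consistent σ τ (hc.resume d) := by
  refine ⟨fun p q h hq => ?_, fun p hp => ?_, fun p hp => ?_⟩
  · by_cases hp : c p = .terminated
    · exact resume_of_terminated hp
    · have hq' : c q ≠ .terminated := fun e => hp (hc.prec p q h (e ▸ Status.noConfusion))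
      rw [resume_of_ne hq'] at hq
      rw [resume_of_ne hp]
      exact hd.prec ⟨p, hp⟩ ⟨q, hq'⟩ h hq
  · by_cases h : c p = .terminated
    · rw [resume_of_terminated h]
      exact Status.noConfusion
    · rw [resume_of_ne h]
      exact hd.src ⟨p, h⟩ hp
  · rw [resume_of_ne (hc.tgt p (hτ hp))]
    exact hd.tgt ⟨p, _⟩ hp

theorem isSubstate_resume {d' : (P.rest hc).carrier → Status} (h : IsSubstate d d') :
    IsSubstate (hc.resume d) (hc.resume d') := fun p hp => by
  by_cases hcp : c p = .terminated
  · rw [resume_of_terminated hcp, resume_of_terminated hcp]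
  · rw [resume_of_ne hcp] at hp ⊢
    rw [resume_of_ne hcp]
    exact h _ hp

end Consistent

end Iposet

namespace Marked

theorem exists_map_eq {V W : Type} {f : V → W} {m : Marked X W} (h : ∀ i, ∃ v, f v = m.2 i) :
    ∃ m' : Marked X V, m'.map f = m := by
  choose g hg using h
  exact ⟨⟨m.1, g⟩, Sigma.ext rfl (heq_of_eq (funext hg))⟩

theorem IsFace.of_map {V W : Type} {f : V → W} (hf : Function.Injective f) {c : W → Status}
    {m m' : Marked X V} (h : IsFace c (m.map f) (m'.map f)) : IsFace (c ∘ f) m m' :=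
  let ⟨φ, h, hA, hB, hX⟩ := h
  ⟨φ, fun i => hf (h i), hA, hB, hX⟩

end Marked

namespace Realization

variable (R : Realization X P x y) (hc : P.Consistent P.S P.T c)

include R

theorem nonempty_rest : Nonempty (Realization X (P.rest hc) (R.cell c).1 y) := by
  let σ : Set (P.rest hc).carrier := Subtype.val ⁻¹' R.σ
  let τ : Set (P.rest hc).carrier := Subtype.val ⁻¹' R.τ
  have hσ : σ ⊆ (P.rest hc).S := fun p hp => by
    by_contra h
    exact hc.src p.1 (R.σ_sub hp) (Iposet.Consistent.unstarted_of_notMem_rest_S h)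
  have hτ : τ ⊆ (P.rest hc).T := fun p hp => R.τ_sub hp
  have consistent : ∀ d, (P.rest hc).Consistent σ τ d →
      P.Consistent R.σ R.τ (hc.resume d) := fun d => Iposet.Consistent.consistent_resume R.τ_sub
  have exists_cell : ∀ d, (P.rest hc).Consistent σ τ d → ∃ m : Marked X (P.rest hc).carrier,
      m.map Subtype.val = R.cell (hc.resume d) := fun d hd =>
    Marked.exists_map_eq fun i => by
      refine ⟨⟨_, fun h => ?_⟩, rfl⟩
      have active := (R.isOver _ (consistent d hd)).active i
      rw [Iposet.Consistent.resume_of_terminated h] at active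
      exact Status.noConfusion active
  have : Nonempty (Marked X (P.rest hc).carrier) :=
    (exists_cell _ (Iposet.consistent_initial hσ)).nonempty
  choose! cell map_cell using exists_cell
  refine ⟨⟨σ, τ, hσ, hτ, cell, fun d hd => ?_, fun d d' hd hd' hs => ?_, ?_, ?_⟩⟩
  · have h := R.isOver _ (consistent d hd)
    rw [← map_cell d hd] at h
    refine ⟨h.mono, fun p => ?_, h.label, h.src, h.tgt⟩
    rw [← congrFun (Iposet.Consistent.resume_comp_val (d := d)) p]
    exact (exists_congr fun i => Subtype.ext_iff).trans (h.range p.1)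
  · have h := R.isFace _ _ (consistent d hd) (consistent d' hd')
      (Iposet.Consistent.isSubstate_resume hs)
    rw [← map_cell d hd, ← map_cell d' hd'] at h
    have := h.of_map Subtype.val_injective
    rwa [Iposet.Consistent.resume_comp_val] at this
  · refine (congrArg Sigma.fst (map_cell _ (Iposet.consistent_initial hσ))).trans ?_
    rw [Iposet.Consistent.resume_initial]
  · refine (congrArg Sigma.fst (map_cell _ (Iposet.consistent_final hτ))).trans ?_
    rw [Iposet.Consistent.resume_final, R.final_fst]

end Realization

end

section

variable {Λ : Type u} {X : IpcSet.{u, w} Λ} {P : Iposet Λ} {x y : X.Cell} {c : P.carrier → Status}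
  {hc : P.Consistent P.S P.T c}

namespace Iposet

theorem isWeakEmbedding_val : (P.rest hc).IsWeakEmbedding P Subtype.val :=
  ⟨Subtype.val_injective, fun _ => rfl, fun _ _ h => h, fun _ _ h _ _ => h⟩

/-- Executing the ilo-set of the events that have been started before the state `c`, and then what
remains after `c`, is an execution of `P`. -/
theorem exists_glue_rest_isomorphic {V : ILoSet Λ} {i : Fin V.n → P.carrier}
    (mono : ∀ a b, a < b → P.ev (i a) (i b)) (label : ∀ a, P.label (i a) = V.label a)
    (minimal : ∀ a q, ¬ P.lt q (i a)) (range : ∀ q, (∃ a, i a = q) ↔ c q ≠ .unstarted)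
    (src : ∀ a, a ∈ V.src ↔ i a ∈ P.S) (tgt : ∀ a, a ∈ V.tgt ↔ c (i a) = .active)
    (lt : ∀ p q, c p = .terminated → c q = .unstarted → P.lt p q) :
    ∃ f : V.toIposet.Matching (P.rest hc), (V.toIposet.glue _ f).Isomorphic P := by
  have started (a) : c (i a) ≠ .unstarted := (range _).1 ⟨a, rfl⟩
  let f : V.toIposet.Matching (P.rest hc) := V.matching (P.rest hc)
    (fun a => ⟨⟨i a.1, fun h => Status.noConfusion (h.symm.trans ((tgt _).1 a.2))⟩,
      (tgt _).1 a.2⟩)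
    (fun q => by
      have active : c q.1.1 = .active := q.2
      obtain ⟨a, ha⟩ := (range q.1.1).2 (active ▸ Status.noConfusion)
      exact ⟨⟨a, (tgt a).2 (ha ▸ active)⟩, Subtype.ext (Subtype.ext ha)⟩)
    (fun a b => mono a b) fun a => label a
  have compat (t : V.toIposet.T) : (f.1 t).1.1 = i t.1 := rfl
  have embedding : V.toIposet.IsWeakEmbedding P i :=
    ⟨injective_of_ev (α := Fin V.n) mono, label, fun a b h => absurd h (minimal b _),
      fun a b h _ _ => mono a b h⟩
  refine ⟨f, (Matching.isWeakEmbedding_desc compat embedding isWeakEmbedding_val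
    (fun a q hq e => ?_) fun a q _ => minimal a q.1).isomorphic
    (Matching.desc_surjective compat fun q => ?_) (Matching.desc_image_S ?_)
    (Matching.desc_image_T compat ?_)
    (Matching.desc_lt compat (fun _ _ h => h.elim) (fun _ _ h => h) fun a ha q hq => ?_)⟩
  · exact started a (e ▸ Consistent.unstarted_of_notMem_rest_S hq)
  · by_cases hq : c q = .unstarted
    · exact Or.inr ⟨⟨q, hq ▸ Status.noConfusion⟩, rfl⟩
    · exact Or.inl ((range q).2 hq)
  · refine Set.ext fun q => ⟨fun hq => ?_, ?_⟩
    · obtain ⟨a, rfl⟩ := (range q).2 (hc.src q hq)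
      exact ⟨a, (src a).2 hq, rfl⟩
    · rintro ⟨a, ha, rfl⟩
      exact (src a).1 ha
  · refine Set.ext fun q => ⟨fun hq => ⟨⟨q, hc.tgt q hq⟩, hq, rfl⟩, ?_⟩
    rintro ⟨q, hq, rfl⟩
    exact hq
  · refine lt _ _ ?_ (Consistent.unstarted_of_notMem_rest_S hq)
    rcases h : c (i a)
    exacts [absurd h (started a), absurd ((tgt a).2 h) ha, rfl]

/-- The number of starts and terminations of events outside of the source interface. -/
noncomputable def size (P : Iposet Λ) : ℕ :=
  Nat.card P.carrier + P.Sᶜ.ncard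

theorem size_rest_lt (h : c ≠ P.initial) : (P.rest hc).size < P.size := by
  have := P.finite
  have maps_to : ∀ p ∈ (P.rest hc).Sᶜ, p.1 ∈ P.Sᶜ := fun p hp hS =>
    hc.src p.1 hS (Consistent.unstarted_of_notMem_rest_S hp)
  have image_subset : Subtype.val '' (P.rest hc).Sᶜ ⊆ P.Sᶜ := Set.image_subset_iff.2 maps_to
  have ncard_image : (Subtype.val '' (P.rest hc).Sᶜ).ncard = (P.rest hc).Sᶜ.ncard :=
    Set.ncard_image_of_injective _ Subtype.val_injective
  obtain ⟨p, hp⟩ := Function.ne_iff.1 h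
  by_cases terminated : c p = .terminated
  · exact Nat.add_lt_add_of_lt_of_le (Finite.card_subtype_lt (x := p) (not_not.2 terminated))
      (ncard_image.symm.trans_le (Set.ncard_le_ncard image_subset))
  · refine Nat.add_lt_add_of_le_of_lt (Finite.card_subtype_le _)
      (ncard_image.symm.trans_lt (Set.ncard_lt_ncard ⟨image_subset, fun subset => ?_⟩))
    have active : c p = .active ∧ p ∉ P.S := by
      by_cases hS : p ∈ P.S
      · rw [initial_eq_active_iff.2 hS] at hp
        rcases e : c p
        exacts [absurd e (hc.src p hS), absurd e hp, absurd e terminated]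
      · rw [initial_eq_unstarted_iff.2 hS] at hp
        rcases e : c p
        exacts [absurd e hp, ⟨rfl, hS⟩, absurd e terminated]
    obtain ⟨q, hq, rfl⟩ := subset active.2
    exact hq active.1

theorem IsInterval.rest (h : P.IsInterval) : (P.rest hc).IsInterval :=
  let ⟨b, e, le, lt_iff⟩ := h
  ⟨fun p => b p.1, fun p => e p.1, fun p => le p.1, fun p q => lt_iff p.1 q.1⟩

open Classical in
theorem consistent_update_initial {p : P.carrier} {s : Status} (minimal : ∀ q, ¬ P.lt q p)
    (hS : p ∈ P.S → s ≠ .unstarted) (hT : p ∈ P.T → s ≠ .terminated) :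
    P.Consistent P.S P.T (Function.update P.initial p s) := by
  have h := P.consistent_initial (τ := P.T) subset_rfl
  refine ⟨fun a b hab hb => ?_, fun a ha => ?_, fun a ha => ?_⟩
  · have ne : b ≠ p := fun e => minimal a (e ▸ hab)
    rw [Function.update_of_ne ne] at hb
    exact absurd (h.prec a b hab hb) initial_ne_terminated
  · rcases eq_or_ne a p with rfl | ne
    · rw [Function.update_self]
      exact hS ha
    · rw [Function.update_of_ne ne]
      exact h.src a ha
  · rcases eq_or_ne a p with rfl | ne
    · rw [Function.update_self]
      exact hT ha
    · rw [Function.update_of_ne ne]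
      exact h.tgt a ha

/-- The event that ends first is terminated first: it precedes whatever has a predecessor. -/
theorem IsInterval.exists_forall_lt (hP : P.IsInterval) (hmin : ∀ q ∉ P.S, ∃ r, P.lt r q)
    (hne : ∃ p, p ∉ P.S ∩ P.T) : ∃ p ∈ P.S, p ∉ P.T ∧ ∀ q ∉ P.S, P.lt p q := by
  by_cases hS : ∀ q, q ∈ P.S
  · obtain ⟨p, hp⟩ := hne
    exact ⟨p, hS p, fun hT => hp ⟨hS p, hT⟩, fun q hq => absurd (hS q) hq⟩
  · obtain ⟨r, hr⟩ := not_forall.1 hS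
    have := P.finite
    have : Nonempty P.carrier := ⟨r⟩
    obtain ⟨b, e, -, lt_iff⟩ := hP
    obtain ⟨p, hp⟩ := Finite.exists_min e
    have lt : ∀ q ∉ P.S, P.lt p q := fun q hq =>
      let ⟨t, ht⟩ := hmin q hq
      (lt_iff p q).2 ((hp t).trans_lt ((lt_iff t q).1 ht))
    exact ⟨p, by_contra fun h => P.lt_irrefl p (lt p h), fun h => P.T_maximal p h r (lt r hr), lt⟩

end Iposet

namespace Realization

variable (R : Realization X P x y)

include R

theorem exists_up_step (hs : IsSubstate P.initial c) :
    ∃ (s : Step X (R.cell P.initial).1 (R.cell c).1) (f : s.ev.Matching (P.rest hc)),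
      (s.ev.glue _ f).Isomorphic P := by
  have hc' : P.Consistent R.σ R.τ c := hc.mono R.σ_sub R.τ_sub
  have m_over := R.isOver c hc'
  obtain ⟨φ, -, hA, hB, h⟩ := R.isFace _ _ (Iposet.consistent_initial R.σ_sub) hc' hs
  have ne_terminated (q) : c q ≠ .terminated := fun e =>
    Iposet.initial_ne_terminated ((hs q (e ▸ Status.noConfusion)).trans e)
  refine ⟨.up φ (hB.trans (Set.eq_empty_of_forall_notMem fun _ => Iposet.initial_ne_terminated)) h,
    Iposet.exists_glue_rest_isomorphic (V := (R.cell c).1.1.withInterfaces φ.Aᶜ Set.univ)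
      m_over.mono m_over.label (fun a q lt => ?_) (fun q => ?_) (fun a => ?_)
      (fun a => iff_of_true trivial (m_over.active a)) fun p _ hp => absurd hp (ne_terminated p)⟩
  · exact ne_terminated q (hc.prec q _ lt (m_over.active a ▸ Status.noConfusion))
  · refine (m_over.range q).trans ?_
    rcases e : c q
    exacts [by simp, by simp, absurd e (ne_terminated q)]
  · change a ∈ φ.Aᶜ ↔ _
    rw [hA]
    exact Iposet.initial_eq_unstarted_iff.not_left

theorem exists_down_step (hs : IsSubstate c P.initial)
    (lt : ∀ p q, c p = .terminated → c q = .unstarted → P.lt p q) :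
    ∃ (s : Step X (R.cell P.initial).1 (R.cell c).1) (f : s.ev.Matching (P.rest hc)),
      (s.ev.glue _ f).Isomorphic P := by
  have hc₀ : P.Consistent R.σ R.τ P.initial := Iposet.consistent_initial R.σ_sub
  have m_over := R.isOver _ hc₀
  have mem_S (a) : (R.cell P.initial).2 a ∈ P.S := Iposet.initial_eq_active_iff.1 (m_over.active a)
  obtain ⟨φ, -, hA, hB, h⟩ := R.isFace _ _ (hc.mono R.σ_sub R.τ_sub) hc₀ hs
  refine ⟨.down φ (hA.trans (Set.eq_empty_of_forall_notMem fun a => hc.src _ (mem_S a))) h,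
    Iposet.exists_glue_rest_isomorphic
      (V := (R.cell P.initial).1.1.withInterfaces Set.univ φ.Bᶜ) m_over.mono m_over.label
      (fun a => P.S_minimal _ (mem_S a)) (fun q => ?_) (fun a => iff_of_true trivial (mem_S a))
      (fun a => ?_) lt⟩
  · refine ((m_over.range q).trans Iposet.initial_eq_active_iff).trans ?_
    refine ⟨hc.src q, fun hq => by_contra fun hS => hq ?_⟩
    have unstarted := Iposet.initial_eq_unstarted_iff.2 hS
    exact (hs q (unstarted ▸ Status.noConfusion)).trans unstarted
  · change a ∈ φ.Bᶜ ↔ _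
    rw [hB]
    change c ((R.cell P.initial).2 a) ≠ .terminated ↔ _
    have := hc.src _ (mem_S a)
    rcases e : c ((R.cell P.initial).2 a)
    exacts [absurd e this, by simp, by simp]

theorem exists_step (hP : P.IsInterval) (hne : ∃ p, p ∉ P.S ∩ P.T) :
    ∃ c ≠ P.initial, ∃ (hc : P.Consistent P.S P.T c) (s : Step X (R.cell P.initial).1 (R.cell c).1)
      (f : s.ev.Matching (P.rest hc)), (s.ev.glue _ f).Isomorphic P := by
  classical
  by_cases hmin : ∃ p ∉ P.S, ∀ q, ¬ P.lt q p
  · obtain ⟨p, hS, hp⟩ := hmin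
    have unstarted := Iposet.initial_eq_unstarted_iff.2 hS
    refine ⟨Function.update P.initial p .active, ?_,
      Iposet.consistent_update_initial hp (fun h => absurd h hS) fun _ => Status.noConfusion,
      R.exists_up_step fun q hq => ?_⟩
    · exact Function.update_ne_self_iff.2 (unstarted ▸ Status.noConfusion)
    · rw [Function.update_of_ne]
      rintro rfl
      exact hq (Function.update_self ..)
  · push Not at hmin
    obtain ⟨p, hS, hT, lt⟩ := hP.exists_forall_lt hmin hne
    have active := Iposet.initial_eq_active_iff.2 hS
    refine ⟨Function.update P.initial p .terminated, ?_,
      Iposet.consistent_update_initial (P.S_minimal p hS) (fun _ => Status.noConfusion)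
        fun h => absurd h hT,
      R.exists_down_step (fun q hq => ?_) fun a b ha hb => ?_⟩
    · exact Function.update_ne_self_iff.2 (active ▸ Status.noConfusion)
    · rw [Function.update_of_ne]
      rintro rfl
      exact hq active
    · have ha : a = p := by
        by_contra ne
        rw [Function.update_of_ne ne] at ha
        exact Iposet.initial_ne_terminated ha
      have hb : b ∉ P.S := fun h => by
        by_cases e : b = p
        · simp [e] at hb
        · rw [Function.update_of_ne e] at hb
          exact Iposet.initial_eq_unstarted_iff.1 hb h
      exact ha ▸ lt b hb

theorem exists_path_of_forall_mem (h : ∀ p, p ∈ P.S ∩ P.T) :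
    ∃ p : Path X x y, P.Isomorphic p.evAux.1 := by
  have final_eq : P.final = P.initial := funext fun p =>
    (Iposet.final_eq_active_iff.2 (h p).2).trans (Iposet.initial_eq_active_iff.2 (h p).1).symm
  have x_eq_y : x = y := R.initial_fst.symm.trans (final_eq ▸ R.final_fst)
  have m_over := R.isOver _ (Iposet.consistent_initial R.σ_sub)
  have not_lt (p q) : ¬ P.lt p q := P.S_minimal q (h q).1 p
  rw [← x_eq_y, ← R.initial_fst]
  exact ⟨.nil _, Iposet.Isomorphic.symm ⟨Equiv.ofBijective (R.cell P.initial).2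
    ⟨m_over.injective, fun p => (m_over.range p).2 (Iposet.initial_eq_active_iff.2 (h p).1)⟩,
    ⟨m_over.label, fun i => iff_of_true (h _).1 trivial, fun i => iff_of_true (h _).2 trivial,
      fun _ _ lt => absurd lt (not_lt _ _), fun i j ij _ _ => m_over.mono i j ij⟩,
    fun _ _ => iff_of_false id (not_lt _ _)⟩⟩

theorem exists_path (hP : P.IsInterval) : ∃ p : Path X x y, P.Isomorphic p.evAux.1 := by
  induction hn : P.size using Nat.strong_induction_on generalizing P x with
  | _ n ih =>
  subst hn
  by_cases h : ∃ p, p ∉ P.S ∩ P.T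
  · obtain ⟨c, hne, hc, s, f, hf⟩ := R.exists_step hP h
    obtain ⟨R'⟩ := R.nonempty_rest hc
    obtain ⟨p, hp⟩ := ih _ (Iposet.size_rest_lt hne) R' hP.rest rfl
    rw [← R.initial_fst]
    exact ⟨.cons s p, hf.symm.trans (hp.glue_right f _)⟩
  · exact R.exists_path_of_forall_mem (by simpa using h)

end Realization

end

/-! ## Operations on languages -/

section

variable {Λ : Type u} {P Q : Iposet Λ} {L M N : Set (Ipomset Λ)}

namespace Iposet

theorem Subsumed.refl (P : Iposet Λ) : P.Subsumed P :=
  (Isomorphic.refl P).subsumed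

theorem IsInterval.of_forall_not_lt (h : ∀ p q, ¬ P.lt p q) : P.IsInterval :=
  ⟨fun _ => 0, fun _ => 0, fun _ => le_rfl, fun p q => iff_of_false (h p q) (lt_self_iff_false _).1⟩

theorem not_lt_of_eq_univ (h : P.S = Set.univ ∨ P.T = Set.univ) (p q : P.carrier) : ¬ P.lt p q := by
  rcases h with h | h
  · exact P.S_minimal q (h ▸ trivial) p
  · exact P.T_maximal p (h ▸ trivial) q

theorem Subsumed.isomorphic_of_eq_univ (h : P.Subsumed Q) (hQ : Q.S = Set.univ ∨ Q.T = Set.univ) :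
    P.Isomorphic Q := by
  obtain ⟨f, hf⟩ := h
  have hP : P.S = Set.univ ∨ P.T = Set.univ :=
    hQ.imp (fun h => Set.eq_univ_of_forall fun p => (hf.S_iff p).1 (Set.eq_univ_iff_forall.1 h _))
      fun h => Set.eq_univ_of_forall fun p => (hf.T_iff p).1 (Set.eq_univ_iff_forall.1 h _)
  exact ⟨f, hf, fun p q => iff_of_false (not_lt_of_eq_univ hP p q) (not_lt_of_eq_univ hQ _ _)⟩

theorem inl_mem_par_S {p : P.carrier} :
    (Sum.inl p : (P.par Q).carrier) ∈ (P.par Q).S ↔ p ∈ P.S := by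
  refine ⟨?_, fun h => Or.inl ⟨p, h, rfl⟩⟩
  rintro (⟨_, h, ⟨⟩⟩ | ⟨_, _, ⟨⟩⟩)
  exact h

theorem inr_mem_par_S {q : Q.carrier} :
    (Sum.inr q : (P.par Q).carrier) ∈ (P.par Q).S ↔ q ∈ Q.S := by
  refine ⟨?_, fun h => Or.inr ⟨q, h, rfl⟩⟩
  rintro (⟨_, _, ⟨⟩⟩ | ⟨_, h, ⟨⟩⟩)
  exact h

theorem inl_mem_par_T {p : P.carrier} :
    (Sum.inl p : (P.par Q).carrier) ∈ (P.par Q).T ↔ p ∈ P.T := by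
  refine ⟨?_, fun h => Or.inl ⟨p, h, rfl⟩⟩
  rintro (⟨_, h, ⟨⟩⟩ | ⟨_, _, ⟨⟩⟩)
  exact h

theorem inr_mem_par_T {q : Q.carrier} :
    (Sum.inr q : (P.par Q).carrier) ∈ (P.par Q).T ↔ q ∈ Q.T := by
  refine ⟨?_, fun h => Or.inr ⟨q, h, rfl⟩⟩
  rintro (⟨_, _, ⟨⟩⟩ | ⟨_, h, ⟨⟩⟩)
  exact h

theorem Subsumed.par {P' Q' : Iposet Λ} (h : P.Subsumed P') (k : Q.Subsumed Q') :
    (P.par Q).Subsumed (P'.par Q') := by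
  obtain ⟨f, hf⟩ := h
  obtain ⟨g, hg⟩ := k
  refine ⟨Equiv.sumCongr f g, ⟨?_, ?_, ?_, ?_, ?_⟩⟩
  · exact Sum.rec hf.label_eq hg.label_eq
  · exact Sum.rec (fun p => inl_mem_par_S.trans ((hf.S_iff p).trans inl_mem_par_S.symm))
      fun q => inr_mem_par_S.trans ((hg.S_iff q).trans inr_mem_par_S.symm)
  · exact Sum.rec (fun p => inl_mem_par_T.trans ((hf.T_iff p).trans inl_mem_par_T.symm))
      fun q => inr_mem_par_T.trans ((hg.T_iff q).trans inr_mem_par_T.symm)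
  · rintro (p | p) (q | q) (h | h)
    · exact .inl (hf.reflects p q h)
    · exact .inr (hg.reflects p q h)
  · rintro (p | p) (q | q) (h | h | _) not_lt not_gt
    · exact .inl (hf.preserves p q h (fun h => not_lt (.inl h)) fun h => not_gt (.inl h))
    · exact .sep _ _
    · exact .inr (hg.preserves p q h (fun h => not_lt (.inr h)) fun h => not_gt (.inr h))

end Iposet

theorem ILoSet.par_isomorphic {n : ℕ} (l : Fin (n + 1) → Λ) (S T : Set (Fin (n + 1))) :
    ((toIposet ⟨1, fun _ => l 0, {_i | 0 ∈ S}, {_i | 0 ∈ T}⟩).par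
      (toIposet ⟨n, fun i => l i.succ, Fin.succ ⁻¹' S, Fin.succ ⁻¹' T⟩)).Isomorphic
      (toIposet ⟨n + 1, l, S, T⟩) := by
  have bijective : Function.Bijective (Sum.elim (fun _ : Fin 1 => (0 : Fin (n + 1))) Fin.succ) := by
    refine ⟨Function.Injective.sumElim (Function.injective_of_subsingleton _)
      (Fin.succ_injective n) fun _ i => (Fin.succ_ne_zero i).symm, fun i => ?_⟩
    exact Fin.cases ⟨Sum.inl 0, rfl⟩ (fun j => ⟨Sum.inr j, rfl⟩) i
  refine ⟨Equiv.ofBijective _ bijective, ⟨?_, ?_, ?_, fun _ _ h => h.elim, ?_⟩, ?_⟩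
  · rintro (i | i) <;> rfl
  · rintro (i | i)
    · exact (Iposet.inl_mem_par_S (p := i)).symm
    · exact (Iposet.inr_mem_par_S (q := i)).symm
  · rintro (i | i)
    · exact (Iposet.inl_mem_par_T (p := i)).symm
    · exact (Iposet.inr_mem_par_T (q := i)).symm
  · rintro (i | i) (j | j) (h | h | _) - -
    · exact absurd h (not_lt.2 (Subsingleton.elim (α := Fin 1) j i).le)
    · exact Fin.succ_pos j
    · exact Fin.succ_lt_succ_iff.2 h
  · rintro _ _
    refine iff_of_false ?_ id
    rintro (h | h) <;> exact h

theorem down_singleton (h : P.S = Set.univ ∨ P.T = Set.univ) :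
    down {Ipomset.mk P} = {Ipomset.mk P} := by
  refine Set.Subset.antisymm ?_ ?_
  · rintro ⟨R⟩ ⟨-, _, rfl, hR⟩
    exact Quotient.sound (Iposet.Subsumed.isomorphic_of_eq_univ hR h)
  · rintro _ rfl
    exact ⟨.of_forall_not_lt (Iposet.not_lt_of_eq_univ h), _, rfl, Iposet.Subsumed.refl P⟩

theorem langPar_singleton :
    langPar {Ipomset.mk P} {Ipomset.mk Q} = down {Ipomset.mk (P.par Q)} := by
  refine Set.Subset.antisymm ?_ ?_
  · rintro ⟨R⟩ ⟨hR, _, ⟨P', Q', hP, hQ, rfl⟩, hs⟩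
    have isoP : P'.Isomorphic P := Quotient.exact hP
    have isoQ : Q'.Isomorphic Q := Quotient.exact hQ
    exact ⟨hR, _, rfl, Iposet.Subsumed.trans hs (isoP.subsumed.par isoQ.subsumed)⟩
  · rintro R ⟨hR, _, rfl, hs⟩
    exact ⟨hR, _, ⟨P, Q, rfl, rfl, rfl⟩, hs⟩

theorem mem_langGlue : Ipomset.mk P ∈ langGlue L M ↔ P.IsInterval ∧
    ∃ (Q R : Iposet Λ) (f : Q.Matching R),
      Ipomset.mk Q ∈ L ∧ Ipomset.mk R ∈ M ∧ P.Subsumed (Q.glue R f) :=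
  ⟨fun ⟨hP, _, ⟨Q, R, f, hQ, hR, e⟩, hs⟩ => ⟨hP, Q, R, f, hQ, hR, by subst e; exact hs⟩,
    fun ⟨hP, Q, R, f, hQ, hR, hs⟩ => ⟨hP, _, ⟨Q, R, f, hQ, hR, rfl⟩, hs⟩⟩

theorem langGlue_mono {L' M' : Set (Ipomset Λ)} (hL : L ⊆ L') (hM : M ⊆ M') :
    langGlue L M ⊆ langGlue L' M' := by
  rintro R ⟨hR, _, ⟨P, Q, f, hP, hQ, rfl⟩, hs⟩
  exact ⟨hR, _, ⟨P, Q, f, hL hP, hM hQ, rfl⟩, hs⟩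

theorem langGlue_union_subset : langGlue L (M ∪ N) ⊆ langGlue L M ∪ langGlue L N := by
  rintro R ⟨hR, _, ⟨P, Q, f, hP, hQ | hQ, rfl⟩, hs⟩
  · exact Or.inl ⟨hR, _, ⟨P, Q, f, hP, hQ, rfl⟩, hs⟩
  · exact Or.inr ⟨hR, _, ⟨P, Q, f, hP, hQ, rfl⟩, hs⟩

theorem langGlue_langGlue_subset (hL : ∀ P ∈ L, P.IsInterval) (hM : ∀ P ∈ M, P.IsInterval) :
    langGlue L (langGlue M N) ⊆ langGlue (langGlue L M) N := by
  rintro ⟨Z⟩ hZ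
  obtain ⟨hZ, P, W, f, hP, hW, Z_sub⟩ := mem_langGlue.1 hZ
  obtain ⟨-, Q, R, g, hQ, hR, W_sub⟩ := mem_langGlue.1 hW
  obtain ⟨k, hk⟩ := W_sub
  let f₁ : P.Matching (Q.glue R g) := LoIso.trans f hk.srcIso
  obtain ⟨f', g', assoc⟩ := Iposet.exists_glue_assoc_subsumed g f₁
  have mem : Ipomset.mk (P.glue Q f') ∈ langGlue L M :=
    mem_langGlue.2 ⟨Iposet.IsInterval.glue (hL _ hP) (hM _ hQ) f', P, Q, f', hP, hQ, .refl _⟩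
  exact mem_langGlue.2 ⟨hZ, _, R, g', mem, hR,
    Z_sub.trans ((Iposet.Subsumed.glue_right ⟨k, hk⟩ f f₁).trans assoc)⟩

theorem isInterval_of_mem_langPow (hL : ∀ P ∈ L, P.IsInterval) :
    ∀ n, ∀ P ∈ langPow L n, P.IsInterval
  | 0 => hL
  | _ + 1 => fun _ hP => hP.1

theorem isInterval_of_mem_langPlus (hL : ∀ P ∈ L, P.IsInterval) :
    ∀ P ∈ langPlus L, P.IsInterval := fun P hP =>
  let ⟨n, hn⟩ := Set.mem_iUnion.1 hP
  isInterval_of_mem_langPow hL n P hn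

theorem subset_langPlus : L ⊆ langPlus L :=
  Set.subset_iUnion (langPow L) 0

theorem langGlue_langPlus_subset : langGlue L (langPlus L) ⊆ langPlus L := by
  rintro R ⟨hR, _, ⟨P, Q, f, hP, hQ, rfl⟩, hs⟩
  obtain ⟨n, hn⟩ := Set.mem_iUnion.1 hQ
  exact Set.mem_iUnion.2 ⟨n + 1, hR, _, ⟨P, Q, f, hP, hn, rfl⟩, hs⟩

theorem langPlus_subset (hL : L ⊆ M) (hM : langGlue M M ⊆ M) : langPlus L ⊆ M := by
  refine Set.iUnion_subset fun n => ?_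
  induction n with
  | zero => exact hL
  | succ n ih => exact (langGlue_mono hL ih).trans hM

namespace IsRational

theorem single_prop (a : Λ) (s t : Prop) :
    IsRational {Ipomset.mk (ILoSet.toIposet ⟨1, fun _ => a, {_i | s}, {_i | t}⟩)} := by
  classical
  simpa [Ipomset.single] using IsRational.single a (decide s) (decide t)

/-- The condition on the interfaces makes a discrete ipomset minimal for subsumption. -/
theorem singleton_toIposet {n : ℕ} (l : Fin n → Λ) (S T : Set (Fin n))
    (h : S = Set.univ ∨ T = Set.univ) :
    IsRational {Ipomset.mk (ILoSet.toIposet ⟨n, l, S, T⟩)} := by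
  induction n with
  | zero =>
    rw [Subsingleton.elim l fun i => i.elim0, Subsingleton.elim S ∅, Subsingleton.elim T ∅]
    exact IsRational.epsilon
  | succ n ih =>
    have mk_par := Quotient.sound (s := Iposet.setoid Λ) (ILoSet.par_isomorphic l S T)
    have tail := ih (fun i => l i.succ) (Fin.succ ⁻¹' S) (Fin.succ ⁻¹' T)
      (h.imp (by rintro rfl; rfl) (by rintro rfl; rfl))
    have par := IsRational.par _ _ (single_prop (l 0) (0 ∈ S) (0 ∈ T)) tail
    rwa [langPar_singleton, Ipomset.mk, mk_par, ← Ipomset.mk, down_singleton h] at par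

theorem biUnion {ι : Type*} {s : Set ι} (hs : s.Finite) {F : ι → Set (Ipomset Λ)}
    (h : ∀ i ∈ s, IsRational (F i)) : IsRational (⋃ i ∈ s, F i) := by
  induction s, hs using Set.Finite.induction_on with
  | empty => simpa using IsRational.empty
  | @insert a s _ _ ih =>
    rw [Set.biUnion_insert]
    exact IsRational.union _ _ (h a (Set.mem_insert a s))
      (ih fun i hi => h i (Set.mem_insert_of_mem a hi))

theorem of_finite (hL : L.Finite) (h : ∀ P ∈ L, IsRational {P}) : IsRational L :=
  Set.biUnion_of_singleton L ▸ biUnion hL h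

end IsRational

end

/-! ## Kleene's construction -/

section

variable {Λ : Type u} {X : IpcSet.{u, w} Λ} {x y : X.Cell} {P : Iposet Λ}

theorem Step.isInterval_ev : (s : Step X x y) → s.ev.IsInterval
  | .up .. | .down .. => .of_forall_not_lt fun _ _ => id

theorem Path.isInterval_evAux (p : Path X x y) : p.evAux.1.IsInterval := by
  induction p with
  | nil => exact .of_forall_not_lt fun _ _ => id
  | cons s p ih => exact s.isInterval_ev.glue ih _

theorem Realization.of_path (p : Path X x y) : Nonempty (Realization X p.evAux.1 x y) := by
  induction p with
  | nil x => exact of_cell x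
  | cons s p ih =>
    obtain ⟨R₁⟩ := of_step s
    obtain ⟨R₂⟩ := ih
    exact ⟨R₁.glue R₂ _⟩

/-- The language of the paths from `x` to `y`. -/
def pathLang (X : IpcSet.{u, w} Λ) (x y : X.Cell) : Set (Ipomset Λ) :=
  {P | ∃ p : Path X x y, P = p.ev}

theorem mem_pathLang_iff :
    Ipomset.mk P ∈ pathLang X x y ↔ P.IsInterval ∧ Nonempty (Realization X P x y) := by
  refine ⟨fun ⟨p, hp⟩ => ?_, fun ⟨hP, ⟨R⟩⟩ => ?_⟩
  · have iso : P.Isomorphic p.evAux.1 := Quotient.exact hp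
    obtain ⟨R⟩ := Realization.of_path p
    exact ⟨.of_iso iso p.isInterval_evAux, R.of_subsumed iso.subsumed⟩
  · obtain ⟨p, hp⟩ := R.exists_path hP
    exact ⟨p, Quotient.sound hp⟩

theorem isInterval_of_mem_pathLang : ∀ P ∈ pathLang X x y, P.IsInterval := by
  rintro ⟨P⟩ hP
  exact (mem_pathLang_iff.1 hP).1

theorem langGlue_pathLang_subset (x y z : X.Cell) :
    langGlue (pathLang X x y) (pathLang X y z) ⊆ pathLang X x z := by
  rintro ⟨P⟩ hP
  obtain ⟨interval, Q, Q', f, hQ, hQ', hs⟩ := mem_langGlue.1 hP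
  obtain ⟨-, ⟨R⟩⟩ := mem_pathLang_iff.1 hQ
  obtain ⟨-, ⟨R'⟩⟩ := mem_pathLang_iff.1 hQ'
  exact mem_pathLang_iff.2 ⟨interval, (R.glue R' f).of_subsumed hs⟩

/-- The ipomsets of the steps from `x` to `y`. -/
def stepLang (X : IpcSet.{u, w} Λ) (x y : X.Cell) : Set (Ipomset Λ) :=
  {P | ∃ s : Step X x y, P = Ipomset.mk s.ev}

theorem stepLang_subset_pathLang : stepLang X x y ⊆ pathLang X x y := by
  rintro _ ⟨s, rfl⟩
  exact mem_pathLang_iff.2 ⟨s.isInterval_ev, Realization.of_step s⟩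

theorem finite_stepLang : (stepLang X x y).Finite := by
  refine ((Set.finite_range fun A : Set (Fin y.1.n) =>
    Ipomset.mk (y.1.withInterfaces Aᶜ Set.univ).toIposet).union
    (Set.finite_range fun B : Set (Fin x.1.n) =>
      Ipomset.mk (x.1.withInterfaces Set.univ Bᶜ).toIposet)).subset ?_
  rintro _ ⟨⟨φ, -, -⟩ | ⟨φ, -, -⟩, rfl⟩
  exacts [Or.inl ⟨φ.A, rfl⟩, Or.inr ⟨φ.B, rfl⟩]

namespace IsRational

theorem stepLang : IsRational (stepLang X x y) := by
  refine of_finite finite_stepLang ?_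
  rintro _ ⟨_ | _, rfl⟩
  exacts [singleton_toIposet _ _ _ (Or.inr rfl), singleton_toIposet _ _ _ (Or.inl rfl)]

theorem singleton_nil_ev (x : X.Cell) : IsRational {(Path.nil x).ev} :=
  singleton_toIposet _ _ _ (Or.inl rfl)

end IsRational

/-- `R` approximates the path languages of `X` from below by rational languages that contain the
ipomsets of all paths whose intermediate cells lie in `K`. -/
structure IsKleeneApprox (X : IpcSet.{u, w} Λ) (K : Set X.Cell)
    (R : X.Cell → X.Cell → Set (Ipomset Λ)) : Prop where
  isRational : ∀ x y, IsRational (R x y)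
  subset_pathLang : ∀ x y, R x y ⊆ pathLang X x y
  nil_mem : ∀ x, (Path.nil x).ev ∈ R x x
  stepLang_subset : ∀ x y, stepLang X x y ⊆ R x y
  langGlue_subset : ∀ x y, ∀ z ∈ K, langGlue (stepLang X x z) (R z y) ⊆ R x y

namespace IsKleeneApprox

variable {K : Set X.Cell} {R : X.Cell → X.Cell → Set (Ipomset Λ)}

theorem empty :
    IsKleeneApprox X ∅ fun x y => stepLang X x y ∪ {P | x = y ∧ P = (Path.nil x).ev} where
  isRational x y := by
    refine .union _ _ .stepLang ?_
    rcases eq_or_ne x y with rfl | ne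
    · simpa using IsRational.singleton_nil_ev x
    · simpa [ne] using IsRational.empty
  subset_pathLang x y := by
    refine Set.union_subset stepLang_subset_pathLang ?_
    rintro _ ⟨rfl, rfl⟩
    exact ⟨.nil x, rfl⟩
  nil_mem x := Or.inr ⟨rfl, rfl⟩
  stepLang_subset x y := Set.subset_union_left
  langGlue_subset x y z hz := hz.elim

/-- The paths from `k` to `y` are split at their visits of `k`. -/
theorem insert (h : IsKleeneApprox X K R) (k : X.Cell) :
    IsKleeneApprox X (insert k K) fun x y =>
      R x y ∪ langGlue (R x k) (R k y ∪ langGlue (langPlus (R k k)) (R k y)) := by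
  let D (y : X.Cell) : Set (Ipomset Λ) := R k y ∪ langGlue (langPlus (R k k)) (R k y)
  have interval (x y) : ∀ P ∈ R x y, P.IsInterval := fun P hP =>
    isInterval_of_mem_pathLang P (h.subset_pathLang x y hP)
  have loops : langPlus (R k k) ⊆ pathLang X k k :=
    langPlus_subset (h.subset_pathLang k k) (langGlue_pathLang_subset k k k)
  have D_subset (y) : D y ⊆ pathLang X k y := Set.union_subset (h.subset_pathLang k y)
    ((langGlue_mono loops (h.subset_pathLang k y)).trans (langGlue_pathLang_subset k k y))
  have loop_D (y) : langGlue (R k k) (D y) ⊆ D y :=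
    langGlue_union_subset.trans <| Set.union_subset
      ((langGlue_mono subset_langPlus subset_rfl).trans Set.subset_union_right)
      (((langGlue_langGlue_subset (interval k k) (isInterval_of_mem_langPlus (interval k k))).trans
        (langGlue_mono langGlue_langPlus_subset subset_rfl)).trans Set.subset_union_right)
  refine ⟨fun x y => ?_, fun x y => ?_, fun x => Or.inl (h.nil_mem x),
    fun x y => (h.stepLang_subset x y).trans Set.subset_union_left, ?_⟩
  · have rat := h.isRational
    exact .union _ _ (rat x y) (.glue _ _ (rat x k)
      (.union _ _ (rat k y) (.glue _ _ (.plus _ (rat k k)) (rat k y))))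
  · exact Set.union_subset (h.subset_pathLang x y)
      ((langGlue_mono (h.subset_pathLang x k) (D_subset y)).trans (langGlue_pathLang_subset x k y))
  · rintro x y z (rfl | hz)
    · exact (langGlue_mono (h.stepLang_subset x z)
        (Set.union_subset Set.subset_union_left (loop_D y))).trans Set.subset_union_right
    · refine langGlue_union_subset.trans
        (Set.union_subset_union (h.langGlue_subset x y z hz) ?_)
      exact (langGlue_langGlue_subset
        (fun P hP => interval x z P (h.stepLang_subset x z hP)) (interval z k)).trans
        (langGlue_mono (h.langGlue_subset x k z hz) subset_rfl)

theorem exists_of_finite (hK : K.Finite) : ∃ R, IsKleeneApprox X K R := by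
  induction K, hK using Set.Finite.induction_on with
  | empty => exact ⟨_, empty⟩
  | insert _ _ ih =>
    obtain ⟨R, h⟩ := ih
    exact ⟨_, h.insert _⟩

theorem ev_mem (h : IsKleeneApprox X Set.univ R) (p : Path X x y) : p.ev ∈ R x y := by
  induction p with
  | nil x => exact h.nil_mem x
  | @cons x y z s p ih =>
    exact h.langGlue_subset x z y trivial <| mem_langGlue.2
      ⟨(Path.cons s p).isInterval_evAux, s.ev, _, _, ⟨s, rfl⟩, ih, .refl _⟩

theorem eq_pathLang (h : IsKleeneApprox X Set.univ R) (x y : X.Cell) : R x y = pathLang X x y :=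
  (h.subset_pathLang x y).antisymm fun _ ⟨p, hp⟩ => hp ▸ h.ev_mem p

end IsKleeneApprox

theorem IsRational.pathLang [Finite X.Cell] (x y : X.Cell) : IsRational (pathLang X x y) := by
  obtain ⟨R, h⟩ := IsKleeneApprox.exists_of_finite (X := X) Set.finite_univ
  exact h.eq_pathLang x y ▸ h.isRational x y

theorem Automaton.lang_eq_biUnion_pathLang (A : Automaton.{u, w} Λ) :
    A.Lang = ⋃ x ∈ A.start, ⋃ y ∈ A.accept, HigherDim.pathLang A.toIpc x y := by
  ext P
  simp only [Automaton.Lang, HigherDim.pathLang, Set.mem_iUnion, exists_prop, Set.mem_ofPred_eq]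

end

end HigherDim

theorem mainTheorem3_general {Λ : Type u} (X : HigherDim.Automaton.{u, w} Λ) :
    HigherDim.IsRational X.Lang := by
  have := X.finite
  rw [X.lang_eq_biUnion_pathLang]
  exact .biUnion (Set.toFinite _) fun x _ => .biUnion (Set.toFinite _) fun y _ => .pathLang x y

theorem mainTheorem3 {Λ : Type u} (L : Set (HigherDim.Ipomset Λ))
    (hL : HigherDim.IsRegular.{u, w} L) : HigherDim.IsRational L := by
  obtain ⟨X, -, rfl⟩ := hL
  exact mainTheorem3_general X
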